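/- **Setting.** Let $d\ge 3$, $\beta>0$, $K\ge 0$, $\sigma>0$, and let $p^\star$ be a probability density on $\mathbb R^d$. For $t>0$ put $\sigma_t=\sqrt{1-e^{-2t}}\,\sigma$, let $$p_t(x)=\int_{\mathbb R^d} (2\pi\sigma_t^2)^{-d/2}e^{-\|x-e^{-t}y\|^2/(2\sigma_t^2)}\,p^\star(y)\,dy$$ be the density at time $t$ of the Ornstein–Uhlenbeck process $dX_t=-X_t\,dt+\sqrt2\,\sigma\,dB_t$, $X_0\sim p^\star$, and let $s^\star(t,x)=\nabla\log p_t(x)$ be its score. Write $S^\star(t,x)=s^\star(t,x)+x/\sigma^2$. *SubGaussian.* $p^\star$ is $K$-subGaussian if $\mathbb P_{Y\sim p^\star}\big(\|Y\|\ge\sqrt{K\log(1/\varepsilon)}\big)\le 2\varepsilon$ for all $0<\varepsilon<1$. *Hölder norm.* For $\eta\ge0$ and $f=(f_1,\dots,f_p)$ on a set $\mathcal X$, $f\in \mathcal C^{\lfloor\eta\rfloor}(\mathcal X)$, $$\|f\|_{\mathcal H^\eta(\mathcal X)}=\max_j\Big\{\sum_{|\nu|\le\lfloor\eta\rfloor}\|\partial^\nu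 f_j\|_{L^\infty(\mathcal X)}+\sum_{|\nu|=\lfloor\eta\rfloor}\ \sup_{x\ne y\in\mathcal X}\frac{|\partial^\nu f_j(x)-\partial^\nu f_j(y)|}{\|x-y\|^{\eta-\lfloor\eta\rfloor}}\Big\}.$$ *Properties $(\mathcal P_\beta)$*, with constants $\mathfrak c=(C_1,C_2,C_\star,(C_\gamma)_\gamma,(C_{k,\gamma})_{k,\gamma})$, $C_1,C_\star>0$. For all $t>0$ and $x\in\mathbb R^d$, * (A) $\|s^\star(t,x)\|\le C_1(1+t^{-1})(1+\|x\|)$; * (B) $\lambda_{\max}\big(\nabla s^\star(t,x)+\sigma^{-2}I\big)\le C_1e^{-2t}\big(1+t^{-(1-(\beta\wedge1)/2)}\big)$, where $\lambda_{\max}(A)=\max_{\|v\|=1}\langle Av,v\rangle$. Moreover there are convex sets $A_0^\varepsilon,A_\infty^\varepsilon\subset \mathrm B\big(0,C_1\log(1/\varepsilon)^{C_2}\big)$, for $\varepsilon\in(0,1/4)$, with $\mathbb P_{X\sim p^\star}(A_\infty^\varepsilon)\ge1-\varepsilon$, such that, setting $A_t^\varepsilon=A_0^\varepsilon$ if $t\le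 C_\star^{-1}\log(1/\varepsilon)^{-C_\star}$ and $A_t^\varepsilon=A_\infty^\varepsilon$ otherwise, the following holds for all $t>0$ and $\varepsilon\in(0,1/4)$: $\int_{A_t^\varepsilon}p_t\ge1-\varepsilon$; $A_t^\varepsilon\subset A_t^{\varepsilon^2}$; $\|x-y\|\ge C_1^{-1}\log(1/\varepsilon)^{-C_2}$ for all $x\in A_t^\varepsilon$, $y\in\partial A_t^{\varepsilon^2}$; and for all $\gamma\ge0$, $k\in\mathbb N_0$, * (C) $\|S^\star(\cdot,x)\|_{\mathcal H^\gamma([t,\infty))}\le C_\gamma\log(1/\varepsilon)^{C_2(1+\gamma)}e^{-t}\big(1+t^{-((\frac12+\gamma-\frac\beta2)\vee0)}\big)$ for all $x\in A_t^\varepsilon$; * (D) $\|\partial_t^kS^\star(t,\cdot)\|_{\mathcal H^\gamma(A_t^\varepsilon)}\le C_{k,\gamma}\log(1/\varepsilon)^{C_2(1+k+\gamma)}e^{-t}\big(1+t^{-((\frac12+k+\frac{\gamma-\beta}2)\vee0)}\big)$. *Loss.* For $0<\underline\tau<\overline\tau$, $\gamma_{[\underline\tau,\overline\tau]}(s,x)=\int_{\underline\tau}^{\overline\tau}\mathbb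 E_{Z\sim\mathcal N(0,I)}\|s(t,e^{-t}x+\sigma_tZ)+Z/\sigma_t\|^2\,dt$. **Proposition (oracle inequality for denoising score matching).** There are constants $C,C'>0$ depending only on $d,\beta,K$ and $\mathfrak c$ such that the following holds. Assume that $p^\star$ is $K$-subGaussian and that $s^\star$ satisfies $(\mathcal P_\beta)$ with constants $\mathfrak c$. Let $n\ge2$, let $X^{(1)},\dots,X^{(n)}$ be i.i.d. from $p^\star(x)\,dx$, let $n^{-1}\le\underline\tau<\overline\tau$, and let $\mathcal S$ be a class of measurable functions $s:\mathbb R_+\times\mathbb R^d\to\mathbb R^d$ with $\sup_{t\in[\underline\tau,\overline\tau]}\|s(t,\cdot)\|_\infty\le V$ for all $s\in\mathcal S$. Let $\widehat s\in\arg\min_{s\in\mathcal S}\frac1n\sum_{i=1}^n\gamma_{[\underline\tau,\overline\tau]}(s,X^{(i)})$. Then $$\mathbb E\Big[\int_{\underline\tau}^{\overline\tau}\!\!\int\|\widehat s(t,x)-s^\star(t,x)\|^2p_t(x)\,dx\,dt\Big]\le3\inf_{s\in\mathcal S}\int_{\underline\tau}^{\overline\tau}\!\!\int\|s(t,x)-s^\star(t,x)\|^2p_t(x)\,dx\,dt+\frac{c_n}{n}\log\Big(\mathcal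 N\big(\mathcal S|_{[\underline\tau,\overline\tau]},\|\cdot\|_\infty,n^{-1}\big)\vee n\Big),$$ where $\mathcal N(\mathcal S|_{[\underline\tau,\overline\tau]},\|\cdot\|_\infty,\delta)\in\mathbb N\cup\{\infty\}$ is the smallest number of closed sup-norm balls of radius $\delta$, centred in the class, that cover the restrictions of the functions of $\mathcal S$ to $[\underline\tau,\overline\tau]\times\mathbb R^d$, and $$c_n=C(\overline\tau-\underline\tau)\log(n)^{C'}g(\underline\tau,\sigma,V),\qquad g(\underline\tau,\sigma,V)=1+V^2+(1+\sigma+\sigma^{-1})^4(1+\underline\tau^{-1})+\frac1{\sigma^2(1-e^{-2\underline\tau})}.$$ -/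

import Mathlib

open MeasureTheory ProbabilityTheory Set
open scoped ENNReal NNReal UniformConvergence

noncomputable section

namespace DSM

/-- The ambient space `ℝ^d` with its Euclidean norm. -/
abbrev Vec (d : ℕ) : Type := EuclideanSpace ℝ (Fin d)

/-! ### Hölder norms -/

section Holder

variable {E : Type*} [NormedAddCommGroup E] [NormedSpace ℝ E]

/-- Derivative of a scalar function on the set `D` in the direction `v`. -/
def dirDeriv (D : Set E) (v : E) (g : E → ℝ) : E → ℝ :=
  fun x => fderivWithin ℝ g D x v

/-- The partial derivative `∂^ν g` on `D` for a multi-index `ν`, with respect to the coordinate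
directions `e 0, …, e (m - 1)`. -/
def multiDeriv {m : ℕ} (e : Fin m → E) (D : Set E) (ν : Fin m → ℕ) (g : E → ℝ) : E → ℝ :=
  (List.finRange m).foldr (fun i h => (dirDeriv D (e i))^[ν i] h) g

/-- `sup_{x ∈ D} |g x|`. -/
def supNormOn (D : Set E) (g : E → ℝ) : ℝ≥0∞ :=
  ⨆ x ∈ D, ENNReal.ofReal |g x|

/-- `sup_{x ≠ y ∈ D} |g x - g y| / ‖x - y‖ ^ α`. -/
def holderSeminormOn (D : Set E) (α : ℝ) (g : E → ℝ) : ℝ≥0∞ :=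
  ⨆ x ∈ D, ⨆ y ∈ D, ⨆ (_ : x ≠ y), ENNReal.ofReal (|g x - g y| / ‖x - y‖ ^ α)

/-- The norm of `H^η(D, ℝ^p)`: the maximum over the components `f_j` of
`∑_{|ν| ≤ ⌊η⌋} ‖∂^ν f_j‖_∞ + ∑_{|ν| = ⌊η⌋} ‖∂^ν f_j‖_{η - ⌊η⌋}`. -/
def holderNorm {m p : ℕ} (e : Fin m → E) (D : Set E) (η : ℝ) (f : E → Vec p) : ℝ≥0∞ :=
  ⨆ j : Fin p,
    ((∑ k ∈ Finset.range (⌊η⌋₊ + 1),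
        ∑ ν ∈ Finset.piAntidiag (Finset.univ : Finset (Fin m)) k,
          supNormOn D (multiDeriv e D ν (fun x => f x j))) +
      ∑ ν ∈ Finset.piAntidiag (Finset.univ : Finset (Fin m)) ⌊η⌋₊,
        holderSeminormOn D (η - (⌊η⌋₊ : ℝ)) (multiDeriv e D ν (fun x => f x j)))

/-- `f` is `⌊η⌋` times continuously differentiable on `D`, with `‖f‖_{H^η(D)} ≤ B`. -/
def InHolderBall {m p : ℕ} (e : Fin m → E) (D : Set E) (η B : ℝ) (f : E → Vec p) : Prop :=
  ContDiffOn ℝ (⌊η⌋₊ : ℕ∞) f D ∧ holderNorm e D η f ≤ ENNReal.ofReal B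

end Holder

/-- The coordinate directions of `ℝ^d`. -/
def spaceDir (d : ℕ) : Fin d → Vec d := fun i => EuclideanSpace.single i 1

/-- The coordinate direction of the time axis. -/
def timeDir : Fin 1 → ℝ := fun _ => 1

/-! ### The target density, the Ornstein-Uhlenbeck marginals and the score -/

/-- `p` is a probability density on `ℝ^d`. -/
structure IsProbDensity {d : ℕ} (p : Vec d → ℝ) : Prop where
  measurable : Measurable p
  nonneg : ∀ x, 0 ≤ p x
  lintegral_eq_one : ∫⁻ x, ENNReal.ofReal (p x) = 1

/-- The measure `p(x) dx`. -/
def law {d : ℕ} (p : Vec d → ℝ) : Measure (Vec d) :=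
  volume.withDensity (fun x => ENNReal.ofReal (p x))

/-- SubGaussian tails: `μ {‖y‖ ≥ √(κ log (1/ε))} ≤ 2 ε` for all `ε ∈ (0,1)`. -/
def IsSubGaussian {d : ℕ} (κ : ℝ) (μ : Measure (Vec d)) : Prop :=
  ∀ ε : ℝ, 0 < ε → ε < 1 →
    μ {y | Real.sqrt (κ * Real.log ε⁻¹) ≤ ‖y‖} ≤ ENNReal.ofReal (2 * ε)

/-- The noise level `σ_t = √(1 - e^{-2t}) σ`. -/
def noise (σ t : ℝ) : ℝ := Real.sqrt (1 - Real.exp (-2 * t)) * σ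

/-- For `t > 0`, the density at time `t` of the solution of `dX = -X dt + √2 σ dB`, `X_0 ∼ p`,
that is of `e^{-t} X_0 + σ_t Z` with `Z` standard Gaussian and independent of `X_0`:
the integral of `p(y)` against the density of `N(e^{-t} y, σ_t² I)`. -/
def marginal {d : ℕ} (σ : ℝ) (p : Vec d → ℝ) (t : ℝ) (x : Vec d) : ℝ :=
  ∫ y, (2 * Real.pi * noise σ t ^ 2) ^ (-(d : ℝ) / 2) *
    Real.exp (-‖x - Real.exp (-t) • y‖ ^ 2 / (2 * noise σ t ^ 2)) * p y

/-- The score `s*(t, x) = ∇ log p_t(x)` for `t > 0`. -/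
def score {d : ℕ} (σ : ℝ) (p : Vec d → ℝ) (t : ℝ) (x : Vec d) : Vec d :=
  gradient (fun y => Real.log (marginal σ p t y)) x

/-- `s*(t, x) + x / σ²`, the deviation of the score from its limit as `t → ∞`. -/
def scoreShift {d : ℕ} (σ : ℝ) (p : Vec d → ℝ) (t : ℝ) (x : Vec d) : Vec d :=
  score σ p t x + (σ ^ 2)⁻¹ • x

/-! ### The score regularity properties `(P_β)` -/

/-- The constants that appear in the properties `(P_β)`. -/
structure ScoreConstants where
  C : ℝ
  C₂ : ℝ
  Cstar : ℝ
  Ctime : ℝ → ℝ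
  Cspace : ℕ → ℝ → ℝ

/-- The high-probability set `A_t^ε`, equal to `A_0^ε` for small times and to `A_∞^ε` for larger
ones. -/
def regSet {d : ℕ} (c : ScoreConstants) (A₀ Ainf : ℝ → Set (Vec d)) (t ε : ℝ) : Set (Vec d) :=
  {x | (t ≤ c.Cstar⁻¹ * Real.log ε⁻¹ ^ (-c.Cstar) ∧ x ∈ A₀ ε) ∨
    (c.Cstar⁻¹ * Real.log ε⁻¹ ^ (-c.Cstar) < t ∧ x ∈ Ainf ε)}

/-- The properties that `A_0^ε` and `A_∞^ε` have to satisfy. -/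
structure IsRegFamily {d : ℕ} (c : ScoreConstants) (β σ : ℝ) (p : Vec d → ℝ)
    (A₀ Ainf : ℝ → Set (Vec d)) : Prop where
  convex_zero : ∀ ε ∈ Ioo (0 : ℝ) (1 / 4), Convex ℝ (A₀ ε)
  convex_inf : ∀ ε ∈ Ioo (0 : ℝ) (1 / 4), Convex ℝ (Ainf ε)
  bounded_zero : ∀ ε ∈ Ioo (0 : ℝ) (1 / 4),
    A₀ ε ⊆ Metric.closedBall 0 (c.C * Real.log ε⁻¹ ^ c.C₂)
  bounded_inf : ∀ ε ∈ Ioo (0 : ℝ) (1 / 4),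
    Ainf ε ⊆ Metric.closedBall 0 (c.C * Real.log ε⁻¹ ^ c.C₂)
  mass_inf : ∀ ε ∈ Ioo (0 : ℝ) (1 / 4), 1 - ε ≤ (law p).real (Ainf ε)
  mass : ∀ t : ℝ, 0 < t → ∀ ε ∈ Ioo (0 : ℝ) (1 / 4),
    1 - ε ≤ ∫ z in regSet c A₀ Ainf t ε, marginal σ p t z
  time_regularity : ∀ t : ℝ, 0 < t → ∀ ε ∈ Ioo (0 : ℝ) (1 / 4),
    ∀ x ∈ regSet c A₀ Ainf t ε, ∀ γ : ℝ, 0 ≤ γ →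
      InHolderBall timeDir (Ici t) γ
        (c.Ctime γ * Real.log ε⁻¹ ^ (c.C₂ * (1 + γ)) * Real.exp (-t) *
          (1 + t ^ (-(max (1 / 2 + γ - β / 2) 0))))
        (fun u => scoreShift σ p u x)
  space_regularity : ∀ t : ℝ, 0 < t → ∀ ε ∈ Ioo (0 : ℝ) (1 / 4), ∀ γ : ℝ, 0 ≤ γ → ∀ k : ℕ,
      InHolderBall (spaceDir d) (regSet c A₀ Ainf t ε) γ
        (c.Cspace k γ * Real.log ε⁻¹ ^ (c.C₂ * (1 + k + γ)) * Real.exp (-t) *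
          (1 + t ^ (-(max (1 / 2 + k + (γ - β) / 2) 0))))
        (fun x => iteratedDeriv k (fun u => scoreShift σ p u x) t)
  nested : ∀ t : ℝ, 0 < t → ∀ ε ∈ Ioo (0 : ℝ) (1 / 4),
    regSet c A₀ Ainf t ε ⊆ regSet c A₀ Ainf t (ε ^ 2)
  separated : ∀ t : ℝ, 0 < t → ∀ ε ∈ Ioo (0 : ℝ) (1 / 4),
    ∀ x ∈ regSet c A₀ Ainf t ε, ∀ y ∈ frontier (regSet c A₀ Ainf t (ε ^ 2)),
      c.C⁻¹ * Real.log ε⁻¹ ^ (-c.C₂) ≤ ‖x - y‖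

/-- The score of `p` satisfies the properties `(P_β)` with constants `c`: linear growth,
one-sided Lipschitz bound (an upper bound on the largest eigenvalue of `∇ s* + σ^{-2} I`), and
space-time Hölder regularity on a structured family of high-probability sets. -/
structure ScoreProperties {d : ℕ} (c : ScoreConstants) (β σ : ℝ) (p : Vec d → ℝ) : Prop where
  C_pos : 0 < c.C
  Cstar_pos : 0 < c.Cstar
  growth : ∀ t : ℝ, 0 < t → ∀ x : Vec d, ‖score σ p t x‖ ≤ c.C * (1 + t⁻¹) * (1 + ‖x‖)
  one_sided : ∀ t : ℝ, 0 < t → ∀ x v : Vec d, ‖v‖ = 1 →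
    inner ℝ (fderiv ℝ (score σ p t) x v + (σ ^ 2)⁻¹ • v) v ≤
      c.C * Real.exp (-2 * t) * (1 + t ^ (-(1 - min β 1 / 2)))
  regular : ∃ A₀ Ainf : ℝ → Set (Vec d), IsRegFamily c β σ p A₀ Ainf

/-! ### Denoising score matching -/

/-- The denoising score matching loss
`γ(s, x) = ∫_{τ₀}^{τ₁} E_Z ‖s(t, e^{-t} x + σ_t Z) + Z / σ_t‖² dt`. -/
def loss {d : ℕ} (σ τ₀ τ₁ : ℝ) (s : ℝ → Vec d → Vec d) (x : Vec d) : ℝ :=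
  ∫ t in τ₀..τ₁, ∫ z, ‖s t (Real.exp (-t) • x + noise σ t • z) + (noise σ t)⁻¹ • z‖ ^ 2
    ∂(stdGaussian (Vec d))

/-- The empirical risk `(1/n) ∑ γ(s, x_i)`. -/
def empiricalRisk {d n : ℕ} (σ τ₀ τ₁ : ℝ) (x : Fin n → Vec d) (s : ℝ → Vec d → Vec d) : ℝ :=
  (n : ℝ)⁻¹ * ∑ i, loss σ τ₀ τ₁ s (x i)

/-- The score error `∫_{τ₀}^{τ₁} ∫ ‖s(t,x) - s*(t,x)‖² p_t(x) dx dt`. -/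
def scoreError {d : ℕ} (σ : ℝ) (p : Vec d → ℝ) (τ₀ τ₁ : ℝ) (s : ℝ → Vec d → Vec d) : ℝ≥0∞ :=
  ∫⁻ t in Icc τ₀ τ₁, ∫⁻ x, ENNReal.ofReal (‖s t x - score σ p t x‖ ^ 2 * marginal σ p t x)

/-- The restriction of `s` to `[τ₀, τ₁] × ℝ^d`, as an element of the space of functions with the
(extended) sup-norm distance. -/
def restrict {d : ℕ} (τ₀ τ₁ : ℝ) (s : ℝ → Vec d → Vec d) :
    (Icc τ₀ τ₁ × Vec d) →ᵤ Vec d :=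
  UniformFun.ofFun (fun q => s q.1 q.2)

/-- The covering number at scale `1/n`, in sup-norm, of the restrictions to `[τ₀, τ₁] × ℝ^d` of
the functions in `S`. -/
def coverNum {d : ℕ} (τ₀ τ₁ : ℝ) (n : ℕ) (S : Set (ℝ → Vec d → Vec d)) : ℕ∞ :=
  Metric.coveringNumber ((n : ℝ≥0)⁻¹) (restrict τ₀ τ₁ '' S)

/-- `log (N ∨ n)`, equal to `∞` if `N = ∞`. -/
def logCover (N : ℕ∞) (n : ℕ) : ℝ≥0∞ :=
  (ENNReal.log (max (N : ℝ≥0∞) (n : ℝ≥0∞))).toENNReal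

/-- `g(τ, σ, V) = 1 + V² + (1 + σ + σ⁻¹)⁴ (1 + τ⁻¹) + 1 / (σ² (1 - e^{-2τ}))`. -/
def gFactor (τ σ V : ℝ) : ℝ :=
  1 + V ^ 2 + (1 + σ + σ⁻¹) ^ 4 * (1 + τ⁻¹) + 1 / (σ ^ 2 * (1 - Real.exp (-2 * τ)))

/-- `c_n = C (τ₁ - τ₀) log(n)^{C'} g(τ₀, σ, V)`. -/
def cFactor (C C' : ℝ) (n : ℕ) (τ₀ τ₁ σ V : ℝ) : ℝ :=
  C * (τ₁ - τ₀) * Real.log n ^ C' * gFactor τ₀ σ V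

end DSM

end

/-!
# An oracle inequality for denoising score matching

The proof is a fast-rate bound for empirical risk minimization, in which the score itself supplies
the tail control.

*Tweedie's formula.* For `t > 0` the score at `X_t = e^{-t} X + σ_t Z` is the conditional mean of
`-Z / σ_t` given `X_t` (`score_eq_tweedie`, by differentiation under the integral). Two things
follow. First, `s*(t, X_t) + Z / σ_t` is orthogonal to every function of `X_t`
(`integral_inner_tweedie_add_eq_zero`), so that the excess risk of `s` over `s*` is exactly the
score error (`integral_excessLoss_eq`, `scoreError_eq`). Second, Jensen's inequality for the
posterior law shows that `s*(t, X_t)` has the same exponential square moments as `Z / σ_t`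
(`lintegral_exp_tweedie_le`); those of `Z` are finite by Fernique's theorem.

*Margin condition.* Write `h_s(x)` for the excess loss at the observation `x`, and `A_s(x)` for the
squared distance of `s` to `s*` averaged over the noise. The identity
`‖a + ζ‖² - ‖b + ζ‖² = ⟨a - b, a + b + 2 ζ⟩` and the Cauchy-Schwarz inequality give
`h_s² ≤ 12 A_s U` and `|h_s| ≤ 12 U` with an envelope `U` that does not depend on `s`
(`sq_excess_loss_le`, `abs_excess_loss_le`). Since `E A_s = E h_s`, the variance of `h_s` on
`{U ≤ b}` is at most `12 b` times its mean. By the above, `U` has an exponential moment of scale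
`κ ≲ (τ₁ - τ₀) (1 + V² + σ_{τ₀}⁻²)` (`lintegral_exp_envelope_le`).

*Oracle inequality* (`lintegral_excess_risk_le`). The losses are truncated at `U ≤ 4 κ log n`, a
level that all observations respect with probability `1 - O(n⁻³)`. On the truncated losses
Bernstein's exponential inequality, with variance bounded by mean, holds at scale `κ log n`; summed
over a finite `1/n`-cover it controls, in expectation, the deviation at the neighbour of the
minimizer in the cover. The sum of exponentials is a measurable majorant, so no measurability of the
minimizer is needed.
-/

namespace DSM

/-! ### Exponential moments -/

/-- A one-step form of Bernstein's inequality: for `|Y| ≤ 1`, the variable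
`exp (E Y - Y - E Y²)` has mean at most one. -/
theorem lintegral_exp_mean_sub_le_one {𝒳 : Type*} [MeasurableSpace 𝒳] {μ : Measure 𝒳}
    [IsProbabilityMeasure μ] {Y : 𝒳 → ℝ} (hY : Measurable Y) (hb : ∀ᵐ x ∂μ, |Y x| ≤ 1) :
    ∫⁻ x, ENNReal.ofReal (Real.exp (∫ y, Y y ∂μ - Y x - ∫ y, Y y ^ 2 ∂μ)) ∂μ ≤ 1 := by
  set m := ∫ y, Y y ∂μ
  set v := ∫ y, Y y ^ 2 ∂μ
  have hYi : Integrable Y μ := Integrable.of_bound hY.aestronglyMeasurable 1 hb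
  have hY2i : Integrable (fun x => Y x ^ 2) μ := by
    refine Integrable.of_bound (hY.pow_const 2).aestronglyMeasurable 1 ?_
    filter_upwards [hb] with x hx
    rw [Real.norm_eq_abs, abs_pow]
    exact pow_le_one₀ (abs_nonneg _) hx
  have hpt : ∀ᵐ x ∂μ, Real.exp (m - Y x - v) ≤ Real.exp (m - v) * (1 - Y x + Y x ^ 2) := by
    filter_upwards [hb] with x hx
    have h1 : |-Y x| ≤ 1 := by rwa [abs_neg]
    have h2 := Real.abs_exp_sub_one_sub_id_le h1
    have h3 := (abs_le.mp h2).2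
    have : Real.exp (m - Y x - v) = Real.exp (m - v) * Real.exp (-Y x) := by
      rw [← Real.exp_add]; ring_nf
    rw [this]
    gcongr
    linarith [neg_sq (Y x)]
  have hint : Integrable (fun x => Real.exp (m - v) * (1 - Y x + Y x ^ 2)) μ :=
    (((integrable_const _).sub hYi).add hY2i).const_mul _
  calc ∫⁻ x, ENNReal.ofReal (Real.exp (m - Y x - v)) ∂μ
      ≤ ∫⁻ x, ENNReal.ofReal (Real.exp (m - v) * (1 - Y x + Y x ^ 2)) ∂μ := by
        refine lintegral_mono_ae ?_
        filter_upwards [hpt] with x hx using ENNReal.ofReal_le_ofReal hx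
    _ = ENNReal.ofReal (∫ x, Real.exp (m - v) * (1 - Y x + Y x ^ 2) ∂μ) := by
        rw [ofReal_integral_eq_lintegral_ofReal hint]
        filter_upwards [hpt] with x hx using (Real.exp_pos _).le.trans hx
    _ ≤ 1 := by
        rw [ENNReal.ofReal_le_one, integral_const_mul, integral_add, integral_sub]
        · simp only [integral_const, probReal_univ, smul_eq_mul, mul_one]
          have h1 : 1 - m + v ≤ Real.exp (-(m - v)) := by
            have := Real.add_one_le_exp (-(m - v)); linarith
          calc Real.exp (m - v) * (1 - m + v) ≤ Real.exp (m - v) * Real.exp (-(m - v)) := by gcongr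
            _ = 1 := by rw [← Real.exp_add]; simp
        · exact integrable_const _
        · exact hYi
        · exact (integrable_const _).sub hYi
        · exact hY2i

/-- The exponential moment of a sum over an i.i.d. sample is at most one if that of each term is. -/
theorem lintegral_exp_sum_le_one {𝒳 Ω : Type*} [MeasurableSpace 𝒳] [MeasurableSpace Ω]
    {μ : Measure 𝒳} {P : Measure Ω} {n : ℕ} {X : Fin n → Ω → 𝒳} (hX : ∀ i, Measurable (X i))
    (hind : iIndepFun X P) (hlaw : ∀ i, P.map (X i) = μ) {f : 𝒳 → ℝ} (hf : Measurable f)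
    (h1 : ∫⁻ x, ENNReal.ofReal (Real.exp (f x)) ∂μ ≤ 1) :
    ∫⁻ ω, ENNReal.ofReal (Real.exp (∑ i, f (X i ω))) ∂P ≤ 1 := by
  have hg : Measurable (fun x => ENNReal.ofReal (Real.exp (f x))) := by fun_prop
  have hprod : ∀ ω, ENNReal.ofReal (Real.exp (∑ i, f (X i ω)))
      = ∏ i, ENNReal.ofReal (Real.exp (f (X i ω))) := by
    intro ω
    rw [Real.exp_sum, ENNReal.ofReal_prod_of_nonneg fun i _ => (Real.exp_pos _).le]
  simp_rw [hprod]
  have hind' := hind.comp (fun _ => fun x => ENNReal.ofReal (Real.exp (f x))) (fun _ => hg)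
  have h2 := lintegral_prod_eq_prod_lintegral_of_indepFun Finset.univ _ hind'
    (fun i => hg.comp (hX i))
  simp only [Function.comp_apply] at h2
  rw [h2]
  refine Finset.prod_le_one' fun i _ => ?_
  have := lintegral_map hg (hX i) (μ := P)
  rw [hlaw i] at this
  exact this.symm.trans_le h1

/-! ### A fast-rate oracle inequality for empirical risk minimizers -/

section Tail

variable {𝒳 : Type*} [MeasurableSpace 𝒳] {μ : Measure 𝒳} {U : 𝒳 → ℝ} {κ K₀ : ℝ}

theorem integrable_exp_div_of_lintegral_le (hU : Measurable U)
    (hexp : ∫⁻ x, ENNReal.ofReal (Real.exp (U x / κ)) ∂μ ≤ ENNReal.ofReal K₀) :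
    Integrable (fun x => Real.exp (U x / κ)) μ := by
  refine ⟨(by fun_prop), ?_⟩
  rw [hasFiniteIntegral_iff_ofReal (Filter.Eventually.of_forall fun x => (Real.exp_pos _).le)]
  exact hexp.trans_lt ENNReal.ofReal_lt_top

theorem integral_exp_div_le (hU : Measurable U) (hK : 0 ≤ K₀)
    (hexp : ∫⁻ x, ENNReal.ofReal (Real.exp (U x / κ)) ∂μ ≤ ENNReal.ofReal K₀) :
    ∫ x, Real.exp (U x / κ) ∂μ ≤ K₀ := by
  rw [integral_eq_lintegral_of_nonneg_ae
    (Filter.Eventually.of_forall fun x => (Real.exp_pos _).le) (by fun_prop)]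
  exact ENNReal.toReal_le_of_le_ofReal hK hexp

theorem integrable_of_exp_div (hκ : 0 < κ) (hU : Measurable U) (hU0 : ∀ᵐ x ∂μ, 0 ≤ U x)
    (hexp : ∫⁻ x, ENNReal.ofReal (Real.exp (U x / κ)) ∂μ ≤ ENNReal.ofReal K₀) :
    Integrable U μ := by
  refine ((integrable_exp_div_of_lintegral_le hU hexp).const_mul κ).mono'
    hU.aestronglyMeasurable ?_
  filter_upwards [hU0] with x hx
  rw [Real.norm_of_nonneg hx]
  have := Real.add_one_le_exp (U x / κ)
  calc U x = κ * (U x / κ) := by field_simp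
    _ ≤ κ * Real.exp (U x / κ) := by gcongr; linarith

theorem integral_le_of_exp_div (hκ : 0 < κ) (hK : 0 ≤ K₀) (hU : Measurable U)
    (hU0 : ∀ᵐ x ∂μ, 0 ≤ U x)
    (hexp : ∫⁻ x, ENNReal.ofReal (Real.exp (U x / κ)) ∂μ ≤ ENNReal.ofReal K₀) :
    ∫ x, U x ∂μ ≤ κ * K₀ := by
  calc ∫ x, U x ∂μ ≤ ∫ x, κ * Real.exp (U x / κ) ∂μ := by
        refine integral_mono (integrable_of_exp_div hκ hU hU0 hexp)
          ((integrable_exp_div_of_lintegral_le hU hexp).const_mul κ) fun x => ?_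
        have := Real.add_one_le_exp (U x / κ)
        calc U x = κ * (U x / κ) := by field_simp
          _ ≤ κ * Real.exp (U x / κ) := by gcongr; linarith
    _ ≤ κ * K₀ := by
        rw [integral_const_mul]
        gcongr
        exact integral_exp_div_le hU hK hexp

/-- The part of the mean of `U` that lies above the level `b` is exponentially small in `b`. -/
theorem integral_indicator_tail_le (hκ : 0 < κ) (hK : 0 ≤ K₀) (hU : Measurable U)
    (hU0 : ∀ᵐ x ∂μ, 0 ≤ U x)
    (hexp : ∫⁻ x, ENNReal.ofReal (Real.exp (U x / κ)) ∂μ ≤ ENNReal.ofReal K₀) (b : ℝ) :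
    ∫ x, {x | b < U x}.indicator U x ∂μ ≤ 2 * κ * K₀ * Real.exp (-(b / (2 * κ))) := by
  have hI := integrable_exp_div_of_lintegral_le hU hexp
  calc ∫ x, {x | b < U x}.indicator U x ∂μ
      ≤ ∫ x, 2 * κ * Real.exp (-(b / (2 * κ))) * Real.exp (U x / κ) ∂μ := by
        refine integral_mono_of_nonneg ?_ (hI.const_mul _) ?_
        · filter_upwards [hU0] with x hx using indicator_apply_nonneg fun _ => hx
        · refine Filter.Eventually.of_forall fun x => ?_
          by_cases hx : b < U x
          · simp only [indicator_of_mem (s := {x | b < U x}) (f := U) hx]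
            have h1 := Real.add_one_le_exp (U x / (2 * κ))
            have h2 : Real.exp (U x / (2 * κ)) ≤
                Real.exp (-(b / (2 * κ))) * Real.exp (U x / κ) := by
              rw [← Real.exp_add, Real.exp_le_exp]
              have h3 : U x / κ = U x / (2 * κ) + U x / (2 * κ) := by field_simp; norm_num
              have h4 : b / (2 * κ) ≤ U x / (2 * κ) := by gcongr
              linarith
            calc U x = 2 * κ * (U x / (2 * κ)) := by field_simp
              _ ≤ 2 * κ * (Real.exp (-(b / (2 * κ))) * Real.exp (U x / κ)) := by
                gcongr; linarith
              _ = _ := by ring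
          · rw [indicator_of_notMem (s := {x | b < U x}) hx]
            positivity
    _ ≤ _ := by
        rw [integral_const_mul]
        have := integral_exp_div_le hU hK hexp
        have h2 : 0 ≤ 2 * κ * Real.exp (-(b / (2 * κ))) := by positivity
        nlinarith

/-- Chernoff's bound. -/
theorem measureReal_tail_le [IsFiniteMeasure μ] (hκ : 0 < κ) (hK : 0 ≤ K₀) (hU : Measurable U)
    (hexp : ∫⁻ x, ENNReal.ofReal (Real.exp (U x / κ)) ∂μ ≤ ENNReal.ofReal K₀) (b : ℝ) :
    μ.real {x | b < U x} ≤ K₀ * Real.exp (-(b / κ)) := by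
  have hI := integrable_exp_div_of_lintegral_le hU hexp
  have h1 := mul_meas_ge_le_integral_of_nonneg
    (Filter.Eventually.of_forall fun x => (Real.exp_pos (U x / κ)).le) hI (Real.exp (b / κ))
  have h2 : μ.real {x | b < U x} ≤ μ.real {x | Real.exp (b / κ) ≤ Real.exp (U x / κ)} := by
    refine measureReal_mono fun x (hx : b < U x) => ?_
    simp only [mem_ofPred_eq, Real.exp_le_exp]
    gcongr
  have h3 := integral_exp_div_le hU hK hexp
  rw [Real.exp_neg, ← div_eq_mul_inv, le_div_iff₀ (Real.exp_pos _)]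
  nlinarith [Real.exp_pos (b / κ)]

end Tail

/-- Bernstein's exponential inequality for a bounded variable `g` whose square is controlled by
a variable `a` (a margin condition): the deviation of `g` below its mean, minus half the mean of
`a`, has an exponential moment of scale `2 M`. -/
theorem lintegral_exp_margin_le_one {𝒳 : Type*} [MeasurableSpace 𝒳] {μ : Measure 𝒳}
    [IsProbabilityMeasure μ] {g a : 𝒳 → ℝ} {M : ℝ} (hM : 0 < M) (hg : Measurable g)
    (ha : Integrable a μ) (hb : ∀ᵐ x ∂μ, |g x| ≤ M) (hsq : ∀ᵐ x ∂μ, g x ^ 2 ≤ M * a x) :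
    ∫⁻ x, ENNReal.ofReal
      (Real.exp ((∫ y, g y ∂μ - g x - (∫ y, a y ∂μ) / 2) / (2 * M))) ∂μ ≤ 1 := by
  have hY : ∀ᵐ x ∂μ, |(2 * M)⁻¹ * g x| ≤ 1 := by
    filter_upwards [hb] with x hx
    rw [abs_mul, abs_of_pos (by positivity), inv_mul_le_one₀ (by positivity)]
    linarith
  refine le_trans (lintegral_mono fun x => ?_)
    (lintegral_exp_mean_sub_le_one (hg.const_mul (2 * M)⁻¹) hY)
  have hv : ∫ y, ((2 * M)⁻¹ * g y) ^ 2 ∂μ ≤ (2 * M)⁻¹ * ((∫ y, a y ∂μ) / 2) := by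
    calc ∫ y, ((2 * M)⁻¹ * g y) ^ 2 ∂μ ≤ ∫ y, (2 * M)⁻¹ * 2⁻¹ * a y ∂μ := by
          refine integral_mono_of_nonneg (Filter.Eventually.of_forall fun x => sq_nonneg _)
            (ha.const_mul _) ?_
          filter_upwards [hsq] with x hx
          calc ((2 * M)⁻¹ * g x) ^ 2 = (2 * M)⁻¹ ^ 2 * g x ^ 2 := by ring
            _ ≤ (2 * M)⁻¹ ^ 2 * (M * a x) := by gcongr
            _ = _ := by field_simp
      _ = _ := by rw [integral_const_mul]; ring
  gcongr
  rw [integral_const_mul, div_eq_inv_mul]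
  linarith [mul_sub (2 * M)⁻¹ (∫ y, g y ∂μ - g x) ((∫ y, a y ∂μ) / 2),
    mul_sub (2 * M)⁻¹ (∫ y, g y ∂μ) (g x)]

/-- The numerical constants of the oracle inequality, with `L = log n` and
`ℓ = log (max N n)`. -/
theorem oracle_constant_le {c κ K₀ L ℓ : ℝ} (hc : 1 ≤ c) (hκ : 0 < κ) (hK : 1 ≤ K₀)
    (hL : 1 / 2 ≤ L) (hℓ : L ≤ ℓ) :
    κ * K₀ + 16 * c * κ * L * ℓ + 8 * κ * L + 4 * c * κ * K₀ + K₀ * (c * κ * K₀ + 8 * c * κ * L)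
      + 16 * c * κ * L + 4 * c * κ * K₀ ≤ 120 * c * K₀ ^ 2 * κ * L * ℓ := by
  have h1 : 1 ≤ 4 * (L * ℓ) := by nlinarith
  have h2 : L ≤ 2 * (L * ℓ) := by nlinarith
  have h0 : 0 ≤ L * ℓ := by linarith
  have hcK : 1 ≤ c * K₀ ^ 2 := by nlinarith
  have hK2 : K₀ ≤ c * K₀ ^ 2 := by nlinarith
  have hc2 : c ≤ c * K₀ ^ 2 := le_mul_of_one_le_right (by linarith) (one_le_pow₀ hK)
  have hcK2 : c * K₀ ≤ c * K₀ ^ 2 := by nlinarith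
  have e1 : K₀ ≤ c * K₀ ^ 2 * (4 * (L * ℓ)) := by nlinarith
  have e2 : c * (L * ℓ) ≤ c * K₀ ^ 2 * (L * ℓ) := by gcongr
  have e3 : L ≤ c * K₀ ^ 2 * (2 * (L * ℓ)) := by nlinarith
  have e4 : c * K₀ ≤ c * K₀ ^ 2 * (4 * (L * ℓ)) := by nlinarith
  have e5 : c * K₀ ^ 2 * 1 ≤ c * K₀ ^ 2 * (4 * (L * ℓ)) := by gcongr
  have e6 : c * K₀ * L ≤ c * K₀ ^ 2 * (2 * (L * ℓ)) := by
    apply mul_le_mul hcK2 h2 <;> nlinarith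
  have e7 : c * L ≤ c * K₀ ^ 2 * (2 * (L * ℓ)) := by
    apply mul_le_mul hc2 h2 <;> nlinarith
  have key : K₀ + 16 * (c * (L * ℓ)) + 8 * L + 4 * (c * K₀) + (c * K₀ ^ 2 * 1 + 8 * (c * K₀ * L))
      + 16 * (c * L) + 4 * (c * K₀) ≤ 120 * (c * K₀ ^ 2 * (L * ℓ)) := by linarith
  calc _ = κ * (K₀ + 16 * (c * (L * ℓ)) + 8 * L + 4 * (c * K₀)
        + (c * K₀ ^ 2 * 1 + 8 * (c * K₀ * L)) + 16 * (c * L) + 4 * (c * K₀)) := by ring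
    _ ≤ κ * (120 * (c * K₀ ^ 2 * (L * ℓ))) := by gcongr
    _ = _ := by ring

theorem integral_affine_combination {Ω : Type*} [MeasurableSpace Ω] {P : Measure Ω}
    [IsProbabilityMeasure P] {B : Set Ω} (hB : MeasurableSet B) {Z Y : Ω → ℝ}
    (hZ : Integrable Z P) (hY : Integrable Y P) (k a p q : ℝ) :
    ∫ ω, (k + B.indicator (fun _ => a) ω + p * Z ω + q * Y ω) ∂P =
      k + P.real B * a + p * ∫ ω, Z ω ∂P + q * ∫ ω, Y ω ∂P := by
  have h1 : Integrable (fun _ : Ω => k) P := integrable_const _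
  have h2 : Integrable (fun ω => B.indicator (fun _ => a) ω) P :=
    (integrable_const _).indicator hB
  have h12 : Integrable (fun ω => k + B.indicator (fun _ => a) ω) P := h1.add h2
  have h123 : Integrable (fun ω => k + B.indicator (fun _ => a) ω + p * Z ω) P :=
    h12.add (hZ.const_mul p)
  rw [integral_add h123 (hY.const_mul q), integral_add h12 (hZ.const_mul p),
    integral_add h1 h2, integral_const_mul, integral_const_mul, integral_indicator hB]
  simp

set_option maxHeartbeats 1000000 in
/-- **Fast-rate oracle inequality for empirical risk minimization.** The excess losses `h s` are
controlled by an envelope `U` with an exponential moment, and satisfy the margin condition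
`h s ^ 2 ≤ c * A s * U`, where `A s ≥ 0` has the same mean as `h s`; the class is covered by the
finite set `T` at scale `U / n`. The empirical minimizer need not be measurable. -/
theorem lintegral_excess_risk_le {𝒳 ι Ω : Type*} [MeasurableSpace 𝒳] [MeasurableSpace Ω]
    {μ : Measure 𝒳} [IsProbabilityMeasure μ] {P : Measure Ω} [IsProbabilityMeasure P]
    {h A : ι → 𝒳 → ℝ} {U : 𝒳 → ℝ} {c κ K₀ : ℝ} (hc : 1 ≤ c) (hκ : 0 < κ) (hK : 1 ≤ K₀)
    {S : Set ι} (hhm : ∀ s ∈ S, Measurable (h s)) (hAm : ∀ s ∈ S, Measurable (A s))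
    (hUm : Measurable U)
    (hexp : ∫⁻ x, ENNReal.ofReal (Real.exp (U x / κ)) ∂μ ≤ ENNReal.ofReal K₀)
    (hbound : ∀ᵐ x ∂μ, 0 ≤ U x ∧ ∀ s ∈ S, 0 ≤ A s x ∧ A s x ≤ c * U x ∧ |h s x| ≤ c * U x ∧
      h s x ^ 2 ≤ c * U x * A s x)
    (hmean : ∀ s ∈ S, ∫ x, h s x ∂μ = ∫ x, A s x ∂μ)
    {T : Finset ι} (hTS : ∀ s ∈ T, s ∈ S) {n : ℕ} (hn : 2 ≤ n) {r : ι → ι}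
    (hr : ∀ s ∈ S, r s ∈ T)
    (hcover : ∀ᵐ x ∂μ, ∀ s ∈ S, |h s x - h (r s) x| ≤ U x / n)
    {X : Fin n → Ω → 𝒳} (hX : ∀ i, Measurable (X i)) (hind : iIndepFun X P)
    (hlaw : ∀ i, P.map (X i) = μ) {shat : Ω → ι}
    (herm : ∀ᵐ ω ∂P, shat ω ∈ S ∧ ∀ s ∈ S, ∑ i, h (shat ω) (X i ω) ≤ ∑ i, h s (X i ω))
    {s : ι} (hs : s ∈ S) :
    ∫⁻ ω, ENNReal.ofReal (∫ x, A (shat ω) x ∂μ) ∂P ≤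
      ENNReal.ofReal (2 * ∫ x, A s x ∂μ +
        120 * c * K₀ ^ 2 * κ * Real.log n * Real.log (max T.card n : ℕ) / n) := by
  have hK0 : 0 ≤ K₀ := by linarith
  have hU0 : ∀ᵐ x ∂μ, 0 ≤ U x := hbound.mono fun x hx => hx.1
  have hUi : Integrable U μ := integrable_of_exp_div hκ hUm hU0 hexp
  have hEU : ∫ x, U x ∂μ ≤ κ * K₀ := integral_le_of_exp_div hκ hK0 hUm hU0 hexp
  have hhi : ∀ j ∈ S, Integrable (h j) μ := fun j hj =>
    (hUi.const_mul c).mono' (hhm j hj).aestronglyMeasurable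
      (hbound.mono fun x hx => (hx.2 j hj).2.2.1)
  have hAi : ∀ j ∈ S, Integrable (A j) μ := fun j hj =>
    (hUi.const_mul c).mono' (hAm j hj).aestronglyMeasurable (hbound.mono fun x hx => by
      rw [Real.norm_of_nonneg (hx.2 j hj).1]; exact (hx.2 j hj).2.1)
  set R : ι → ℝ := fun j => ∫ x, A j x ∂μ with hR
  have hR0 : ∀ j ∈ S, 0 ≤ R j := fun j hj =>
    integral_nonneg_of_ae (hbound.mono fun x hx => (hx.2 j hj).1)
  have hRle : ∀ j ∈ S, R j ≤ c * κ * K₀ := fun j hj => by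
    calc R j ≤ ∫ x, c * U x ∂μ := integral_mono_ae (hAi j hj) (hUi.const_mul c)
          (hbound.mono fun x hx => (hx.2 j hj).2.1)
      _ = c * ∫ x, U x ∂μ := integral_const_mul _ _
      _ ≤ c * (κ * K₀) := by gcongr
      _ = _ := by ring
  have hn0 : (0 : ℝ) < n := by positivity
  have hn2 : (2 : ℝ) ≤ n := by exact_mod_cast hn
  set L := Real.log n with hLdef
  have hL : 1 / 2 ≤ L := by
    have h1 : Real.log 2 ≤ L := Real.log_le_log (by norm_num) hn2
    have := Real.log_two_gt_d9
    linarith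
  -- The truncation level: large enough for the tail mean of `U` to be `O(κ / n)`, and for all
  -- observations to lie below it except with probability `O(1 / n)`.
  set b := 4 * κ * L with hb
  have hb0 : 0 < b := by positivity
  have hcb : 0 < c * b := by positivity
  set good : Set 𝒳 := {x | U x ≤ b} with hgood
  have hgoodm : MeasurableSet good := measurableSet_le hUm measurable_const
  set ht : ι → 𝒳 → ℝ := fun j => good.indicator (h j) with hht
  have htm : ∀ j ∈ S, Measurable (ht j) := fun j hj => (hhm j hj).indicator hgoodm
  have hti : ∀ j ∈ S, Integrable (ht j) μ := fun j hj => (hhi j hj).indicator hgoodm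
  have htb : ∀ᵐ x ∂μ, ∀ j ∈ S, |ht j x| ≤ c * b := by
    filter_upwards [hbound] with x hx j hj
    by_cases hxg : x ∈ good
    · simp only [hht, indicator_of_mem hxg]
      exact (hx.2 j hj).2.2.1.trans (by gcongr; exact hxg)
    · simp only [hht, indicator_of_notMem hxg, abs_zero]
      exact hcb.le
  have htsq : ∀ᵐ x ∂μ, ∀ j ∈ S, ht j x ^ 2 ≤ c * b * A j x := by
    filter_upwards [hbound] with x hx j hj
    have hA0 := (hx.2 j hj).1
    by_cases hxg : x ∈ good
    · simp only [hht, indicator_of_mem hxg]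
      exact (hx.2 j hj).2.2.2.trans (by gcongr; exact hxg)
    · simp only [hht, indicator_of_notMem hxg]
      have : 0 ≤ c * b * A j x := by positivity
      simpa using this
  -- The error of the truncation.
  have hexp2 : Real.exp (-(b / (2 * κ))) = (n : ℝ)⁻¹ ^ 2 := by
    have : b / (2 * κ) = L + L := by rw [hb]; field_simp; norm_num
    rw [this, neg_add, Real.exp_add, Real.exp_neg, hLdef, Real.exp_log hn0]; ring
  have hexp1 : Real.exp (-(b / κ)) = (n : ℝ)⁻¹ ^ 4 := by
    have : -(b / κ) = -(b / (2 * κ)) + -(b / (2 * κ)) := by field_simp; ring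
    rw [this, Real.exp_add, hexp2]; ring
  have hninv : (n : ℝ)⁻¹ ≤ 1 := inv_le_one_of_one_le₀ (by linarith)
  have hninv0 : 0 < (n : ℝ)⁻¹ := by positivity
  set ρ := ∫ x, {x | b < U x}.indicator U x ∂μ with hρ
  have hρle : ρ ≤ 2 * κ * K₀ * (n : ℝ)⁻¹ := by
    refine (integral_indicator_tail_le hκ hK0 hUm hU0 hexp b).trans ?_
    rw [hexp2]
    gcongr
    nlinarith
  have htail : ∀ j ∈ S, |∫ x, h j x ∂μ - ∫ x, ht j x ∂μ| ≤ c * ρ := by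
    intro j hj
    rw [← integral_sub (hhi j hj) (hti j hj), hρ, ← integral_const_mul]
    refine abs_integral_le_integral_abs.trans ?_
    refine integral_mono_ae ((hhi j hj).sub (hti j hj)).abs
      ((hUi.indicator (measurableSet_lt measurable_const hUm)).const_mul c) ?_
    filter_upwards [hbound] with x hx
    by_cases hxg : x ∈ good
    · have hx' : U x ≤ b := hxg
      have : x ∉ {x | b < U x} := by simpa using hx'
      simp only [hht, indicator_of_mem hxg, indicator_of_notMem this]
      simp
    · have : x ∈ {x | b < U x} := by simpa [hgood] using hxg
      simp only [hht, indicator_of_notMem hxg, indicator_of_mem this, sub_zero]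
      exact (hx.2 j hj).2.2.1
  -- The exceptional event that some observation exceeds the truncation level.
  set bad : Set Ω := {ω | ∃ i, X i ω ∉ good} with hbad
  have hbadm : MeasurableSet bad := by
    have : bad = ⋃ i, X i ⁻¹' goodᶜ := by ext ω; simp [hbad]
    rw [this]
    exact MeasurableSet.iUnion fun i => hX i hgoodm.compl
  have hPbad : P.real bad ≤ K₀ * (n : ℝ)⁻¹ := by
    have h1 : bad = ⋃ i, X i ⁻¹' goodᶜ := by ext ω; simp [hbad]
    have h2 : ∀ i, P.real (X i ⁻¹' goodᶜ) ≤ K₀ * (n : ℝ)⁻¹ ^ 4 := by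
      intro i
      have h3 : P.real (X i ⁻¹' goodᶜ) = μ.real goodᶜ := by
        rw [← hlaw i, map_measureReal_apply (hX i) hgoodm.compl]
      have h4 : goodᶜ = {x | b < U x} := by ext x; simp [hgood]
      rw [h3, h4, ← hexp1]
      exact measureReal_tail_le hκ hK0 hUm hexp b
    calc P.real bad ≤ ∑ i : Fin n, P.real (X i ⁻¹' goodᶜ) := by
          rw [h1]; exact measureReal_iUnion_fintype_le _
      _ ≤ ∑ i : Fin n, K₀ * (n : ℝ)⁻¹ ^ 4 := Finset.sum_le_sum fun i _ => h2 i
      _ = K₀ * ((n : ℝ)⁻¹ * (n : ℝ)⁻¹ * (n : ℝ)⁻¹) := by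
          rw [Finset.sum_const, Finset.card_univ, Fintype.card_fin, nsmul_eq_mul]; field_simp
      _ ≤ K₀ * (n : ℝ)⁻¹ := by
          gcongr
          exact mul_le_of_le_one_left hninv0.le (mul_le_one₀ hninv hninv0.le hninv)
  -- Almost sure properties transfer to the sample.
  have hae : ∀ {q : 𝒳 → Prop}, (∀ᵐ x ∂μ, q x) → ∀ᵐ ω ∂P, ∀ i, q (X i ω) := by
    intro q hq
    rw [ae_all_iff]
    intro i
    have h1 : ∀ᵐ x ∂(P.map (X i)), q x := by rwa [hlaw i]
    exact ae_of_ae_map (hX i).aemeasurable h1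
  -- `φ j` is the deviation of `ht j` below its mean, less `R j / 2`, at the Bernstein scale; the
  -- sum `Z` of the exponentials over the cover replaces a union bound.
  set φ : ι → 𝒳 → ℝ := fun j x => (∫ y, ht j y ∂μ - ht j x - R j / 2) / (2 * (c * b)) with hφ
  have hφm : ∀ j ∈ S, Measurable (φ j) := fun j hj => by
    have := htm j hj
    simp only [hφ]; fun_prop
  set Z : Ω → ℝ := fun ω => ∑ j ∈ T, Real.exp (∑ i, φ j (X i ω)) with hZ
  have hexpj : ∀ j ∈ T, ∫⁻ ω, ENNReal.ofReal (Real.exp (∑ i, φ j (X i ω))) ∂P ≤ 1 := fun j hj =>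
    lintegral_exp_sum_le_one hX hind hlaw (hφm j (hTS j hj))
      (lintegral_exp_margin_le_one hcb (htm j (hTS j hj)) (hAi j (hTS j hj))
        (htb.mono fun x hx => hx j (hTS j hj)) (htsq.mono fun x hx => hx j (hTS j hj)))
  have hexpm : ∀ j ∈ T, Measurable fun ω => Real.exp (∑ i, φ j (X i ω)) := fun j hj => by
    have h1 := hφm j (hTS j hj)
    exact Real.measurable_exp.comp (Finset.measurable_sum _ fun i _ => h1.comp (hX i))
  have hexpi : ∀ j ∈ T, Integrable (fun ω => Real.exp (∑ i, φ j (X i ω))) P := fun j hj => by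
    refine ⟨(hexpm j hj).aestronglyMeasurable, ?_⟩
    rw [hasFiniteIntegral_iff_ofReal (Filter.Eventually.of_forall fun x => (Real.exp_pos _).le)]
    exact (hexpj j hj).trans_lt ENNReal.one_lt_top
  have hZi : Integrable Z P := integrable_finsetSum _ hexpi
  have hZle : ∫ ω, Z ω ∂P ≤ T.card := by
    rw [hZ, integral_finsetSum _ hexpi, Finset.cast_card]
    refine Finset.sum_le_sum fun j hj => ?_
    rw [integral_eq_lintegral_of_nonneg_ae
      (Filter.Eventually.of_forall fun x => (Real.exp_pos _).le)
      (hexpm j hj).aestronglyMeasurable]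
    exact ENNReal.toReal_le_of_le_ofReal zero_le_one (by simpa using hexpj j hj)
  have hN : 0 < T.card := Finset.card_pos.mpr ⟨r s, hr s hs⟩
  have hN0 : (0 : ℝ) < T.card := by exact_mod_cast hN
  -- The integrable majorant of the risk. On the exceptional event only the crude bound `c κ K₀` on
  -- the risk is used, and `2 c b` makes up for a negative empirical mean of `ht s`.
  set K₁ : ℝ := κ * K₀ * (n : ℝ)⁻¹ +
    2 * (n : ℝ)⁻¹ * (2 * (c * b) * Real.log T.card + b) + 2 * (c * ρ) with hK₁
  set F : Ω → ℝ := fun ω => K₁ + bad.indicator (fun _ => c * κ * K₀ + 2 * (c * b)) ω +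
    4 * (c * b) * (n : ℝ)⁻¹ * (T.card : ℝ)⁻¹ * Z ω +
    2 * (n : ℝ)⁻¹ * ∑ i, ht s (X i ω) with hF
  have hρ0 : 0 ≤ ρ := integral_nonneg_of_ae
    (hU0.mono fun x hx => indicator_apply_nonneg fun _ => hx)
  have hlogN0 : 0 ≤ Real.log T.card := Real.log_nonneg (by exact_mod_cast hN)
  have hK₁0 : 0 ≤ K₁ := by positivity
  have hmaj : ∀ᵐ ω ∂P, R (shat ω) ≤ F ω := by
    filter_upwards [herm, hae htb, hae hcover, hae hbound] with ω hω htbω hcovω hbω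
    obtain ⟨hJS, hmin⟩ := hω
    have hZ0 : 0 ≤ Z ω := Finset.sum_nonneg fun j _ => (Real.exp_pos _).le
    by_cases hωb : ω ∈ bad
    · have h1 : -(n * (c * b)) ≤ ∑ i, ht s (X i ω) := by
        calc -(n * (c * b)) = ∑ i : Fin n, -(c * b) := by simp
          _ ≤ _ := Finset.sum_le_sum fun i _ => (abs_le.mp (htbω i s hs)).1
      have h2 : -(2 * (c * b)) ≤ 2 * (n : ℝ)⁻¹ * ∑ i, ht s (X i ω) := by
        calc -(2 * (c * b)) = 2 * (n : ℝ)⁻¹ * -(n * (c * b)) := by field_simp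
          _ ≤ _ := by gcongr
      have h3 : 0 ≤ 4 * (c * b) * (n : ℝ)⁻¹ * (T.card : ℝ)⁻¹ * Z ω := by positivity
      simp only [hF, indicator_of_mem hωb]
      linarith [hRle _ hJS]
    · have hg : ∀ i, X i ω ∈ good := by simpa [hbad] using hωb
      have hhteq : ∀ j i, ht j (X i ω) = h j (X i ω) := fun j i => indicator_of_mem (hg i) _
      set J := r (shat ω) with hJ
      have hJT : J ∈ T := hr _ hJS
      have hJS' : J ∈ S := hTS J hJT
      -- The risk of the minimizer is close to that of its neighbour in the cover.
      have h1 : R (shat ω) ≤ R J + κ * K₀ * (n : ℝ)⁻¹ := by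
        have e1 : |∫ x, h (shat ω) x ∂μ - ∫ x, h J x ∂μ| ≤ ∫ x, U x / n ∂μ := by
          rw [← integral_sub (hhi _ hJS) (hhi _ hJS')]
          refine abs_integral_le_integral_abs.trans ?_
          exact integral_mono_ae ((hhi _ hJS).sub (hhi _ hJS')).abs (hUi.div_const _)
            (hcover.mono fun x hx => hx _ hJS)
        rw [hmean _ hJS, hmean _ hJS', integral_div] at e1
        have e2 : (∫ x, U x ∂μ) / n ≤ κ * K₀ * (n : ℝ)⁻¹ := by
          rw [div_eq_mul_inv]; gcongr
        have := (abs_le.mp e1).2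
        simp only [hR]
        linarith
      -- From `u + 1 ≤ exp u` at `u = ∑ φ J - log N`.
      have h2 : ∑ i, φ J (X i ω) ≤ Real.log T.card + (T.card : ℝ)⁻¹ * Z ω := by
        have e1 : Real.exp (∑ i, φ J (X i ω)) ≤ Z ω :=
          Finset.single_le_sum (f := fun j => Real.exp (∑ i, φ j (X i ω)))
            (fun j _ => (Real.exp_pos _).le) hJT
        have e2 := Real.add_one_le_exp (∑ i, φ J (X i ω) - Real.log T.card)
        rw [Real.exp_sub, Real.exp_log hN0] at e2
        have e3 : Real.exp (∑ i, φ J (X i ω)) / T.card ≤ (T.card : ℝ)⁻¹ * Z ω := by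
          rw [div_eq_inv_mul]; gcongr
        linarith
      have h3 : ∑ i, φ J (X i ω) * (2 * (c * b)) =
          n * (∫ y, ht J y ∂μ) - ∑ i, ht J (X i ω) - n * (R J / 2) := by
        have : ∀ i, φ J (X i ω) * (2 * (c * b)) =
            ∫ y, ht J y ∂μ - ht J (X i ω) - R J / 2 := fun i => by
          simp only [hφ]; field_simp
        simp only [this, Finset.sum_sub_distrib, Finset.sum_const, Finset.card_univ,
          Fintype.card_fin, nsmul_eq_mul]
      rw [← Finset.sum_mul] at h3
      have h4 : R J ≤ ∫ y, ht J y ∂μ + c * ρ := by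
        have := (abs_le.mp (htail J hJS')).2
        rw [hmean J hJS'] at this
        simp only [hR]; linarith
      have h5 : ∑ i, ht J (X i ω) ≤ ∑ i, ht s (X i ω) + b := by
        calc ∑ i, ht J (X i ω) ≤ ∑ i, (h (shat ω) (X i ω) + b / n) := by
              refine Finset.sum_le_sum fun i _ => ?_
              rw [hhteq]
              have e1 := (abs_le.mp (hcovω i _ hJS)).1
              have e2 : U (X i ω) / n ≤ b / n := by gcongr; exact hg i
              linarith
          _ = ∑ i, h (shat ω) (X i ω) + b := by
              rw [Finset.sum_add_distrib, Finset.sum_const, Finset.card_univ, Fintype.card_fin,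
                nsmul_eq_mul]
              field_simp
          _ ≤ ∑ i, h s (X i ω) + b := by gcongr 1; exact hmin s hs
          _ = _ := by simp only [hhteq]
      have h6 : (∑ i, φ J (X i ω)) * (2 * (c * b)) ≤
          (Real.log T.card + (T.card : ℝ)⁻¹ * Z ω) * (2 * (c * b)) := by gcongr
      have h7 : n * (R J / 2) ≤ (Real.log T.card + (T.card : ℝ)⁻¹ * Z ω) * (2 * (c * b)) +
          ∑ i, ht s (X i ω) + b + n * (c * ρ) := by
        have : n * R J ≤ n * (∫ y, ht J y ∂μ + c * ρ) := by gcongr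
        linarith
      have h8 : R J ≤ 2 * (n : ℝ)⁻¹ * ((Real.log T.card + (T.card : ℝ)⁻¹ * Z ω) * (2 * (c * b)) +
          ∑ i, ht s (X i ω) + b + n * (c * ρ)) := by
        calc R J = 2 * (n : ℝ)⁻¹ * (n * (R J / 2)) := by field_simp
          _ ≤ _ := by gcongr
      have h9 : 2 * (n : ℝ)⁻¹ * (n * (c * ρ)) = 2 * (c * ρ) := by field_simp
      simp only [hF, indicator_of_notMem hωb, hK₁]
      linarith
  have hsumi : ∀ i, Integrable (fun ω => ht s (X i ω)) P := fun i => by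
    have h1 : Integrable (ht s) (P.map (X i)) := by rw [hlaw i]; exact hti s hs
    exact h1.comp_measurable (hX i)
  have hsumE : ∫ ω, ∑ i, ht s (X i ω) ∂P = n * ∫ x, ht s x ∂μ := by
    rw [integral_finsetSum _ fun i _ => hsumi i]
    have : ∀ i, ∫ ω, ht s (X i ω) ∂P = ∫ x, ht s x ∂μ := fun i => by
      rw [← hlaw i, integral_map (hX i).aemeasurable (htm s hs).aestronglyMeasurable]
    simp [this]
  have hFi : Integrable F P :=
    (((integrable_const _).add ((integrable_const _).indicator hbadm)).add
      (hZi.const_mul _)).add ((integrable_finsetSum _ fun i _ => hsumi i).const_mul _)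
  have hFE : ∫ ω, F ω ∂P = K₁ + P.real bad * (c * κ * K₀ + 2 * (c * b)) +
      4 * (c * b) * (n : ℝ)⁻¹ * (T.card : ℝ)⁻¹ * ∫ ω, Z ω ∂P +
      2 * (n : ℝ)⁻¹ * (n * ∫ x, ht s x ∂μ) := by
    rw [← hsumE]
    exact integral_affine_combination hbadm hZi (integrable_finsetSum _ fun i _ => hsumi i) _ _ _ _
  have hnn : 2 * (n : ℝ)⁻¹ * (n * ∫ x, ht s x ∂μ) = 2 * ∫ x, ht s x ∂μ := by
    rw [← mul_assoc, mul_assoc 2, inv_mul_cancel₀ hn0.ne', mul_one]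
  have hFle : ∫ ω, F ω ∂P ≤ 2 * ∫ x, A s x ∂μ +
        120 * c * K₀ ^ 2 * κ * Real.log n * Real.log (max T.card n : ℕ) / n := by
    set ℓ := Real.log (max T.card n : ℕ) with hℓ
    have hℓL : L ≤ ℓ := Real.log_le_log hn0 (by exact_mod_cast le_max_right _ _)
    have hℓN : Real.log T.card ≤ ℓ := Real.log_le_log hN0 (by exact_mod_cast le_max_left _ _)
    have e1 : ∫ x, ht s x ∂μ ≤ ∫ x, A s x ∂μ + c * ρ := by
      have := (abs_le.mp (htail s hs)).1
      rw [hmean s hs] at this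
      linarith
    have e2 : 4 * (c * b) * (n : ℝ)⁻¹ * (T.card : ℝ)⁻¹ * ∫ ω, Z ω ∂P ≤
        4 * (c * b) * (n : ℝ)⁻¹ := by
      calc _ ≤ 4 * (c * b) * (n : ℝ)⁻¹ * (T.card : ℝ)⁻¹ * T.card := by gcongr
        _ = _ := by field_simp
    have e3 : P.real bad * (c * κ * K₀ + 2 * (c * b)) ≤
        K₀ * (n : ℝ)⁻¹ * (c * κ * K₀ + 2 * (c * b)) := by gcongr
    have e4 : K₁ ≤ κ * K₀ * (n : ℝ)⁻¹ +
        2 * (n : ℝ)⁻¹ * (2 * (c * b) * ℓ + b) + 2 * (c * (2 * κ * K₀ * (n : ℝ)⁻¹)) := by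
      rw [hK₁]; gcongr
    have e5 : c * ρ ≤ c * (2 * κ * K₀ * (n : ℝ)⁻¹) := by gcongr
    have e6 := mul_le_mul_of_nonneg_right (oracle_constant_le hc hκ hK hL hℓL) hninv0.le
    rw [hFE, hnn, div_eq_mul_inv]
    rw [hb] at e2 e3 e4
    linarith
  calc ∫⁻ ω, ENNReal.ofReal (∫ x, A (shat ω) x ∂μ) ∂P ≤ ∫⁻ ω, ENNReal.ofReal (F ω) ∂P :=
        lintegral_mono_ae (hmaj.mono fun ω hω => ENNReal.ofReal_le_ofReal hω)
    _ = ENNReal.ofReal (∫ ω, F ω ∂P) := by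
        rw [ofReal_integral_eq_lintegral_ofReal hFi]
        filter_upwards [hmaj, herm] with ω h1 h2 using (hR0 _ h2.1).trans h1
    _ ≤ _ := ENNReal.ofReal_le_ofReal hFle

/-! ### Square losses over a finite measure space -/

section Envelope

variable {W H : Type*} [MeasurableSpace W] [NormedAddCommGroup H] {ρ : Measure W}

theorem integrable_sq_norm_of_memLp {f : W → H} (hf : MemLp f 2 ρ) :
    Integrable (fun w => ‖f w‖ ^ 2) ρ :=
  (memLp_two_iff_integrable_sq_norm hf.1).mp hf

theorem integral_norm_sq_le_of_bound [IsFiniteMeasure ρ] {a : W → H} {V : ℝ}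
    (haV : ∀ᵐ w ∂ρ, ‖a w‖ ≤ V) :
    ∫ w, ‖a w‖ ^ 2 ∂ρ ≤ ρ.real univ * V ^ 2 := by
  calc ∫ w, ‖a w‖ ^ 2 ∂ρ ≤ ∫ _, V ^ 2 ∂ρ := by
        refine integral_mono_of_nonneg (Filter.Eventually.of_forall fun w => sq_nonneg _)
          (integrable_const _) ?_
        filter_upwards [haV] with w hw
        gcongr
    _ = _ := by simp

/-- The envelope of the excess losses: `(2 + V²) ρ(W) + ∫ ‖b‖² + ∫ ‖ζ‖²`. -/
noncomputable def envelope (ρ : Measure W) (V : ℝ) (b ζ : W → H) : ℝ :=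
  ρ.real univ * (2 + V ^ 2) + ∫ w, (‖b w‖ ^ 2 + ‖ζ w‖ ^ 2) ∂ρ

theorem envelope_nonneg (V : ℝ) (b ζ : W → H) : 0 ≤ envelope ρ V b ζ := by
  have : 0 ≤ ∫ w, (‖b w‖ ^ 2 + ‖ζ w‖ ^ 2) ∂ρ := integral_nonneg fun w => by positivity
  have h2 : 0 ≤ ρ.real univ := measureReal_nonneg
  unfold envelope
  positivity

theorem envelope_eq {V : ℝ} {b ζ : W → H} (hb : MemLp b 2 ρ) (hζ : MemLp ζ 2 ρ) :
    envelope ρ V b ζ = ρ.real univ * (2 + V ^ 2) + ∫ w, ‖b w‖ ^ 2 ∂ρ + ∫ w, ‖ζ w‖ ^ 2 ∂ρ := by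
  rw [envelope, integral_add (integrable_sq_norm_of_memLp hb) (integrable_sq_norm_of_memLp hζ)]
  ring

theorem integral_norm_sub_sq_le [IsFiniteMeasure ρ] {a b ζ : W → H} {V : ℝ}
    (ha : MemLp a 2 ρ) (hb : MemLp b 2 ρ) (hζ : MemLp ζ 2 ρ) (haV : ∀ᵐ w ∂ρ, ‖a w‖ ≤ V) :
    ∫ w, ‖a w - b w‖ ^ 2 ∂ρ ≤ 2 * envelope ρ V b ζ := by
  have ha2 := integrable_sq_norm_of_memLp ha
  have hb2 := integrable_sq_norm_of_memLp hb
  have h1 : ∫ w, ‖a w - b w‖ ^ 2 ∂ρ ≤ ∫ w, (2 * ‖a w‖ ^ 2 + 2 * ‖b w‖ ^ 2) ∂ρ := by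
    refine integral_mono_of_nonneg (Filter.Eventually.of_forall fun w => sq_nonneg _)
      ((ha2.const_mul 2).add (hb2.const_mul 2)) (Filter.Eventually.of_forall fun w => ?_)
    have := norm_sub_le (a w) (b w)
    have h0 := norm_nonneg (a w - b w)
    simp only
    nlinarith [sq_nonneg (‖a w‖ - ‖b w‖)]
  rw [integral_add (ha2.const_mul 2) (hb2.const_mul 2), integral_const_mul,
    integral_const_mul] at h1
  have h2 := integral_norm_sq_le_of_bound haV
  have h3 : 0 ≤ ∫ w, ‖ζ w‖ ^ 2 ∂ρ := integral_nonneg fun w => sq_nonneg _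
  have h4 : 0 ≤ ρ.real univ := measureReal_nonneg
  rw [envelope_eq hb hζ]
  linarith

end Envelope

section SquareLoss

variable {W H : Type*} [MeasurableSpace W] [NormedAddCommGroup H] [InnerProductSpace ℝ H]
  {ρ : Measure W}

theorem integrable_inner_of_memLp {f g : W → H} (hf : MemLp f 2 ρ) (hg : MemLp g 2 ρ) :
    Integrable (fun w => inner ℝ (f w) (g w)) ρ := by
  have h := hf.norm.integrable_mul hg.norm
  exact h.mono' (hf.1.inner hg.1) (Filter.Eventually.of_forall fun w => norm_inner_le_norm _ _)

/-- The Cauchy-Schwarz inequality. -/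
theorem sq_integral_inner_le {f g : W → H} (hf : MemLp f 2 ρ) (hg : MemLp g 2 ρ) :
    (∫ w, inner ℝ (f w) (g w) ∂ρ) ^ 2 ≤ (∫ w, ‖f w‖ ^ 2 ∂ρ) * ∫ w, ‖g w‖ ^ 2 ∂ρ := by
  have hfg := integrable_inner_of_memLp hf hg
  have hf2 := integrable_sq_norm_of_memLp hf
  have hg2 := integrable_sq_norm_of_memLp hg
  have key : ∀ x : ℝ, 0 ≤ (∫ w, ‖g w‖ ^ 2 ∂ρ) * (x * x) +
      (2 * ∫ w, inner ℝ (f w) (g w) ∂ρ) * x + ∫ w, ‖f w‖ ^ 2 ∂ρ := by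
    intro x
    have h : ∀ w, ‖f w + x • g w‖ ^ 2 =
        (x * x) * ‖g w‖ ^ 2 + (2 * x) * inner ℝ (f w) (g w) + ‖f w‖ ^ 2 := by
      intro w
      rw [norm_add_sq_real, norm_smul, inner_smul_right, mul_pow, Real.norm_eq_abs, sq_abs]; ring
    have h0 : 0 ≤ ∫ w, ‖f w + x • g w‖ ^ 2 ∂ρ := integral_nonneg fun w => sq_nonneg _
    simp_rw [h] at h0
    rw [integral_add, integral_add, integral_const_mul, integral_const_mul] at h0
    · linarith
    · exact hg2.const_mul _
    · exact hfg.const_mul _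
    · exact (hg2.const_mul _).add (hfg.const_mul _)
    · exact hf2
  have := discrim_le_zero key
  rw [discrim] at this
  linarith

variable {a a' b ζ : W → H} {V : ℝ}

theorem norm_add_sq_sub_norm_add_sq (u v z : H) :
    ‖u + z‖ ^ 2 - ‖v + z‖ ^ 2 = inner ℝ (u - v) (u + v + (2 : ℝ) • z) := by
  simp only [← real_inner_self_eq_norm_sq, inner_add_left, inner_add_right, inner_sub_left,
    inner_smul_right, real_inner_comm v u, real_inner_comm z u, real_inner_comm z v]
  ring

theorem integral_norm_add_sq_sub (ha : MemLp a 2 ρ) (hb : MemLp b 2 ρ) (hζ : MemLp ζ 2 ρ) :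
    ∫ w, ‖a w + ζ w‖ ^ 2 ∂ρ - ∫ w, ‖b w + ζ w‖ ^ 2 ∂ρ =
      ∫ w, inner ℝ (a w - b w) (a w + b w + (2 : ℝ) • ζ w) ∂ρ := by
  have h1 := integrable_sq_norm_of_memLp (ha.add hζ)
  have h2 := integrable_sq_norm_of_memLp (hb.add hζ)
  simp only [Pi.add_apply] at h1 h2
  rw [← integral_sub h1 h2]
  simp_rw [norm_add_sq_sub_norm_add_sq]

/-- The excess loss is the squared distance plus a cross term, which Tweedie's formula removes in
mean. -/
theorem integral_norm_add_sq_sub_eq (ha : MemLp a 2 ρ) (hb : MemLp b 2 ρ) (hζ : MemLp ζ 2 ρ) :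
    ∫ w, ‖a w + ζ w‖ ^ 2 ∂ρ - ∫ w, ‖b w + ζ w‖ ^ 2 ∂ρ =
      ∫ w, ‖a w - b w‖ ^ 2 ∂ρ + 2 * ∫ w, inner ℝ (a w - b w) (b w + ζ w) ∂ρ := by
  have h1 := integrable_sq_norm_of_memLp (ha.sub hb)
  have h2 := integrable_inner_of_memLp (ha.sub hb) (hb.add hζ)
  simp only [Pi.add_apply, Pi.sub_apply] at h1 h2
  rw [integral_norm_add_sq_sub ha hb hζ, ← integral_const_mul, ← integral_add h1 (h2.const_mul 2)]
  congr 1 with w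
  rw [← real_inner_self_eq_norm_sq]
  simp only [inner_add_right, inner_smul_right, inner_sub_right]
  ring

variable [IsFiniteMeasure ρ]

/-- The margin condition for the square loss. -/
theorem sq_excess_loss_le (ha : MemLp a 2 ρ) (hb : MemLp b 2 ρ) (hζ : MemLp ζ 2 ρ)
    (haV : ∀ᵐ w ∂ρ, ‖a w‖ ≤ V) :
    (∫ w, ‖a w + ζ w‖ ^ 2 ∂ρ - ∫ w, ‖b w + ζ w‖ ^ 2 ∂ρ) ^ 2 ≤
      12 * envelope ρ V b ζ * ∫ w, ‖a w - b w‖ ^ 2 ∂ρ := by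
  have ha2 := integrable_sq_norm_of_memLp ha
  have hb2 := integrable_sq_norm_of_memLp hb
  have hζ2 := integrable_sq_norm_of_memLp hζ
  have hcs := sq_integral_inner_le (ha.sub hb) ((ha.add hb).add (hζ.const_smul (2 : ℝ)))
  simp only [Pi.add_apply, Pi.sub_apply, Pi.smul_apply] at hcs
  rw [integral_norm_add_sq_sub ha hb hζ]
  have h1 : ∫ w, ‖a w + b w + (2 : ℝ) • ζ w‖ ^ 2 ∂ρ ≤
      ∫ w, (3 * ‖a w‖ ^ 2 + 3 * ‖b w‖ ^ 2 + 12 * ‖ζ w‖ ^ 2) ∂ρ := by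
    refine integral_mono_of_nonneg (Filter.Eventually.of_forall fun w => sq_nonneg _)
      (((ha2.const_mul 3).add (hb2.const_mul 3)).add (hζ2.const_mul 12))
      (Filter.Eventually.of_forall fun w => ?_)
    have h := norm_add₃_le (a := a w) (b := b w) (c := (2 : ℝ) • ζ w)
    rw [norm_smul, Real.norm_ofNat] at h
    have h0 := norm_nonneg (a w + b w + (2 : ℝ) • ζ w)
    simp only
    nlinarith [sq_nonneg (‖a w‖ - ‖b w‖), sq_nonneg (‖a w‖ - 2 * ‖ζ w‖),
      sq_nonneg (‖b w‖ - 2 * ‖ζ w‖)]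
  have hi : Integrable (fun w => 3 * ‖a w‖ ^ 2 + 3 * ‖b w‖ ^ 2) ρ :=
    (ha2.const_mul 3).add (hb2.const_mul 3)
  rw [integral_add hi (hζ2.const_mul 12), integral_add (ha2.const_mul 3) (hb2.const_mul 3),
    integral_const_mul, integral_const_mul, integral_const_mul] at h1
  have h2 := integral_norm_sq_le_of_bound haV
  have h3 : 0 ≤ ∫ w, ‖b w‖ ^ 2 ∂ρ := integral_nonneg fun w => sq_nonneg _
  have h4 : 0 ≤ ρ.real univ := measureReal_nonneg
  have h5 : 0 ≤ ρ.real univ * V ^ 2 := by positivity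
  have h6 : ∫ w, ‖a w + b w + (2 : ℝ) • ζ w‖ ^ 2 ∂ρ ≤ 12 * envelope ρ V b ζ := by
    rw [envelope_eq hb hζ]
    linarith
  have h7 : 0 ≤ ∫ w, ‖a w - b w‖ ^ 2 ∂ρ := integral_nonneg fun w => sq_nonneg _
  calc _ ≤ _ := hcs
    _ ≤ (∫ w, ‖a w - b w‖ ^ 2 ∂ρ) * (12 * envelope ρ V b ζ) := by gcongr
    _ = _ := mul_comm _ _

theorem abs_excess_loss_le (ha : MemLp a 2 ρ) (hb : MemLp b 2 ρ) (hζ : MemLp ζ 2 ρ)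
    (haV : ∀ᵐ w ∂ρ, ‖a w‖ ≤ V) :
    |∫ w, ‖a w + ζ w‖ ^ 2 ∂ρ - ∫ w, ‖b w + ζ w‖ ^ 2 ∂ρ| ≤ 12 * envelope ρ V b ζ := by
  have hU : 0 ≤ envelope ρ V b ζ := envelope_nonneg V b ζ
  refine abs_le_of_sq_le_sq ?_ (by positivity)
  have h1 := sq_excess_loss_le ha hb hζ haV
  have h2 := integral_norm_sub_sq_le ha hb hζ haV
  nlinarith

/-- Stability of the loss under uniform perturbations; the linear factor `2 V + 2 ‖ζ‖` is absorbed
by the envelope. -/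
theorem abs_loss_sub_le (ha : MemLp a 2 ρ) (ha' : MemLp a' 2 ρ) (hb : MemLp b 2 ρ)
    (hζ : MemLp ζ 2 ρ) (haV : ∀ᵐ w ∂ρ, ‖a w‖ ≤ V) (haV' : ∀ᵐ w ∂ρ, ‖a' w‖ ≤ V) {δ : ℝ}
    (hδ : 0 ≤ δ) (hd : ∀ᵐ w ∂ρ, ‖a w - a' w‖ ≤ δ) :
    |∫ w, ‖a w + ζ w‖ ^ 2 ∂ρ - ∫ w, ‖a' w + ζ w‖ ^ 2 ∂ρ| ≤ δ * envelope ρ V b ζ := by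
  have hζ2 := integrable_sq_norm_of_memLp hζ
  rw [integral_norm_add_sq_sub ha ha' hζ]
  have hi : Integrable (fun w => δ * (2 + V ^ 2 + ‖ζ w‖ ^ 2)) ρ :=
    ((integrable_const _).add hζ2).const_mul δ
  have h1 : ‖∫ w, inner ℝ (a w - a' w) (a w + a' w + (2 : ℝ) • ζ w) ∂ρ‖ ≤
      ∫ w, δ * (2 + V ^ 2 + ‖ζ w‖ ^ 2) ∂ρ := by
    refine norm_integral_le_of_norm_le hi ?_
    filter_upwards [haV, haV', hd] with w h1 h2 h3
    have h := norm_add₃_le (a := a w) (b := a' w) (c := (2 : ℝ) • ζ w)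
    rw [norm_smul, Real.norm_ofNat] at h
    refine (norm_inner_le_norm _ _).trans ?_
    gcongr
    nlinarith [sq_nonneg (V - 1), sq_nonneg (‖ζ w‖ - 1)]
  rw [integral_const_mul, integral_add (integrable_const _) hζ2] at h1
  simp only [integral_const, smul_eq_mul] at h1
  rw [← Real.norm_eq_abs]
  refine h1.trans ?_
  rw [envelope_eq hb hζ]
  have : 0 ≤ ∫ w, ‖b w‖ ^ 2 ∂ρ := integral_nonneg fun w => sq_nonneg _
  gcongr
  linarith

end SquareLoss

/-! ### Jensen's inequality for exponential moments -/

/-- Jensen's inequality for the exponential. For a non-integrable `f ≥ 0` the left-hand side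
is `exp 0`, so that no integrability is needed. -/
theorem ofReal_exp_integral_le {W : Type*} [MeasurableSpace W] {ν : Measure W}
    [IsProbabilityMeasure ν] {f : W → ℝ} (hf : 0 ≤ f) :
    ENNReal.ofReal (Real.exp (∫ w, f w ∂ν)) ≤ ∫⁻ w, ENNReal.ofReal (Real.exp (f w)) ∂ν := by
  by_cases hi : Integrable f ν
  · set m := ∫ w, f w ∂ν
    have hI : Integrable (fun w => Real.exp m * (1 + f w - m)) ν :=
      (((integrable_const _).add hi).sub (integrable_const _)).const_mul _
    have h1 : ENNReal.ofReal (∫ w, Real.exp m * (1 + f w - m) ∂ν) ≤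
        ∫⁻ w, ENNReal.ofReal (Real.exp m * (1 + f w - m)) ∂ν := by
      rw [integral_eq_lintegral_pos_part_sub_lintegral_neg_part hI]
      refine (ENNReal.ofReal_le_ofReal (sub_le_self _ ENNReal.toReal_nonneg)).trans ?_
      exact ENNReal.ofReal_toReal_le
    have h2 : ∫ w, Real.exp m * (1 + f w - m) ∂ν = Real.exp m := by
      have hi' : Integrable (fun w => 1 + f w) ν := (integrable_const _).add hi
      rw [integral_const_mul, integral_sub hi' (integrable_const _),
        integral_add (integrable_const _) hi]
      simp [m]
    rw [h2] at h1
    refine h1.trans (lintegral_mono fun w => ENNReal.ofReal_le_ofReal ?_)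
    have := Real.add_one_le_exp (f w - m)
    calc Real.exp m * (1 + f w - m) ≤ Real.exp m * Real.exp (f w - m) := by gcongr; linarith
      _ = Real.exp (f w) := by rw [← Real.exp_add]; ring_nf
  · rw [integral_undef hi]
    calc ENNReal.ofReal (Real.exp 0) = ∫⁻ _, 1 ∂ν := by simp
      _ ≤ _ := lintegral_mono fun w => by
        rw [ENNReal.one_le_ofReal]
        exact Real.one_le_exp (hf w)

theorem exp_half_add_le (p q : ℝ) :
    Real.exp ((p + q) / 2) ≤ (Real.exp p + Real.exp q) / 2 := by
  have h1 : Real.exp ((p + q) / 2) = Real.exp (p / 2) * Real.exp (q / 2) := by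
    rw [← Real.exp_add]; ring_nf
  have h2 : Real.exp p = Real.exp (p / 2) ^ 2 := by rw [← Real.exp_nat_mul]; ring_nf
  have h3 : Real.exp q = Real.exp (q / 2) ^ 2 := by rw [← Real.exp_nat_mul]; ring_nf
  rw [h1, h2, h3]
  nlinarith [sq_nonneg (Real.exp (p / 2) - Real.exp (q / 2))]

/-- The envelope inherits exponential moments from `‖b‖²` and `‖ζ‖²`. -/
theorem lintegral_exp_envelope_le {𝒳 W H : Type*} [MeasurableSpace 𝒳] [MeasurableSpace W]
    [NormedAddCommGroup H] [InnerProductSpace ℝ H] [MeasurableSpace H]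
    [OpensMeasurableSpace H] {μ : Measure 𝒳} {ρ : Measure W} [SFinite μ]
    [IsFiniteMeasure ρ] (hρ : 0 < ρ.real univ) {b ζ : 𝒳 → W → H}
    (hb : Measurable (Function.uncurry b)) (hζ : Measurable (Function.uncurry ζ)) {k K V : ℝ}
    (hk : 0 < k)
    (hbk : ∫⁻ w, ∫⁻ x, ENNReal.ofReal (Real.exp (k * ‖b x w‖ ^ 2)) ∂μ ∂ρ ≤
      ρ univ * ENNReal.ofReal K)
    (hζk : ∫⁻ w, ∫⁻ x, ENNReal.ofReal (Real.exp (k * ‖ζ x w‖ ^ 2)) ∂μ ∂ρ ≤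
      ρ univ * ENNReal.ofReal K) :
    ∫⁻ x, ENNReal.ofReal (Real.exp (envelope ρ V (b x) (ζ x) /
      (ρ.real univ * (2 + V ^ 2 + 2 / k)))) ∂μ ≤ ENNReal.ofReal (Real.exp 1 * K) := by
  set D := ρ.real univ with hD
  have hne : ρ univ ≠ 0 := fun h => by simp [hD, measureReal_def, h] at hρ
  have hnt : ρ univ ≠ ⊤ := measure_ne_top ρ univ
  set ν : Measure W := (ρ univ)⁻¹ • ρ with hν
  have : IsProbabilityMeasure ν := ⟨by simp [hν, ENNReal.inv_mul_cancel hne hnt]⟩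
  have hpt : ∀ x, ENNReal.ofReal (Real.exp (envelope ρ V (b x) (ζ x) /
      (D * (2 + V ^ 2 + 2 / k)))) ≤ ENNReal.ofReal (Real.exp 1 / 2) * ((ρ univ)⁻¹ *
        (∫⁻ w, ENNReal.ofReal (Real.exp (k * ‖b x w‖ ^ 2)) ∂ρ +
          ∫⁻ w, ENNReal.ofReal (Real.exp (k * ‖ζ x w‖ ^ 2)) ∂ρ)) := by
    intro x
    set f : W → ℝ := fun w => (k * ‖b x w‖ ^ 2 + k * ‖ζ x w‖ ^ 2) / 2 with hf
    have hf0 : 0 ≤ f := fun w => by simp only [hf, Pi.zero_apply]; positivity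
    have h1 : ∫ w, f w ∂ν = k / (2 * D) * ∫ w, (‖b x w‖ ^ 2 + ‖ζ x w‖ ^ 2) ∂ρ := by
      rw [hν, integral_smul_measure, ← integral_const_mul, smul_eq_mul, ← integral_const_mul]
      congr 1 with w
      simp only [hf, ENNReal.toReal_inv, hD, measureReal_def]
      field_simp
    have hI : 0 ≤ ∫ w, (‖b x w‖ ^ 2 + ‖ζ x w‖ ^ 2) ∂ρ := integral_nonneg fun w => by positivity
    have h2 : envelope ρ V (b x) (ζ x) / (D * (2 + V ^ 2 + 2 / k)) ≤ 1 + ∫ w, f w ∂ν := by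
      rw [h1, envelope, div_le_iff₀ (by positivity), ← hD]
      set I := ∫ w, (‖b x w‖ ^ 2 + ‖ζ x w‖ ^ 2) ∂ρ
      have e1 : k / (2 * D) * I * (D * (2 / k)) = I := by field_simp
      have e2 : 0 ≤ k / (2 * D) * I * (D * (2 + V ^ 2)) := by positivity
      have e3 : 0 ≤ D * (2 / k) := by positivity
      nlinarith
    calc ENNReal.ofReal (Real.exp (envelope ρ V (b x) (ζ x) / (D * (2 + V ^ 2 + 2 / k))))
        ≤ ENNReal.ofReal (Real.exp (1 + ∫ w, f w ∂ν)) := by gcongr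
      _ = ENNReal.ofReal (Real.exp 1) * ENNReal.ofReal (Real.exp (∫ w, f w ∂ν)) := by
          rw [Real.exp_add, ENNReal.ofReal_mul (Real.exp_pos _).le]
      _ ≤ ENNReal.ofReal (Real.exp 1) * ∫⁻ w, ENNReal.ofReal (Real.exp (f w)) ∂ν := by
          gcongr; exact ofReal_exp_integral_le hf0
      _ ≤ ENNReal.ofReal (Real.exp 1) * ∫⁻ w, ENNReal.ofReal (1 / 2) *
            (ENNReal.ofReal (Real.exp (k * ‖b x w‖ ^ 2)) +
              ENNReal.ofReal (Real.exp (k * ‖ζ x w‖ ^ 2))) ∂ν := by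
          gcongr with w
          rw [← ENNReal.ofReal_add (Real.exp_pos _).le (Real.exp_pos _).le,
            ← ENNReal.ofReal_mul (by norm_num)]
          refine ENNReal.ofReal_le_ofReal ((exp_half_add_le _ _).trans_eq ?_)
          ring
      _ = _ := by
          have hbx : Measurable (b x) := hb.of_uncurry_left
          have hζx : Measurable (ζ x) := hζ.of_uncurry_left
          rw [lintegral_const_mul _ (by fun_prop), lintegral_add_left (by fun_prop), hν,
            lintegral_smul_measure, lintegral_smul_measure, smul_eq_mul, smul_eq_mul, ← mul_assoc,
            ← ENNReal.ofReal_mul (Real.exp_pos _).le, ← mul_add]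
          congr 2
          ring
  have hbm : Measurable fun q : 𝒳 × W => ENNReal.ofReal (Real.exp (k * ‖b q.1 q.2‖ ^ 2)) := by
    have : Measurable fun q : 𝒳 × W => b q.1 q.2 := hb
    fun_prop
  have hζm : Measurable fun q : 𝒳 × W => ENNReal.ofReal (Real.exp (k * ‖ζ q.1 q.2‖ ^ 2)) := by
    have : Measurable fun q : 𝒳 × W => ζ q.1 q.2 := hζ
    fun_prop
  have hb1 := hbm.lintegral_prod_right' (ν := ρ)
  have hζ1 := hζm.lintegral_prod_right' (ν := ρ)
  have hbs := lintegral_lintegral_swap (μ := μ) (ν := ρ)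
    (f := fun x w => ENNReal.ofReal (Real.exp (k * ‖b x w‖ ^ 2))) hbm.aemeasurable
  have hζs := lintegral_lintegral_swap (μ := μ) (ν := ρ)
    (f := fun x w => ENNReal.ofReal (Real.exp (k * ‖ζ x w‖ ^ 2))) hζm.aemeasurable
  refine (lintegral_mono hpt).trans ?_
  rw [lintegral_const_mul _ (by fun_prop), lintegral_const_mul _ (by fun_prop),
    lintegral_add_left hb1, hbs, hζs]
  calc _ ≤ ENNReal.ofReal (Real.exp 1 / 2) * ((ρ univ)⁻¹ * (ρ univ * ENNReal.ofReal K +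
        ρ univ * ENNReal.ofReal K)) := by gcongr
    _ = ENNReal.ofReal (Real.exp 1 / 2) * (2 * ENNReal.ofReal K) := by
        rw [← mul_add, ← mul_assoc (ρ univ)⁻¹, ENNReal.inv_mul_cancel hne hnt, one_mul, two_mul]
    _ = _ := by
        rw [← ENNReal.ofReal_ofNat 2, ← ENNReal.ofReal_mul (by norm_num),
          ← ENNReal.ofReal_mul (by positivity)]
        congr 1; ring

/-! ### The Gaussian kernel -/

/-- The density at `y` of the Gaussian law `N(m, s² I)` on `ℝ^d`. -/
noncomputable def gaussKernel {d : ℕ} (s : ℝ) (m y : Vec d) : ℝ :=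
  (2 * Real.pi * s ^ 2) ^ (-(d : ℝ) / 2) * Real.exp (-‖y - m‖ ^ 2 / (2 * s ^ 2))

section Kernel

variable {d : ℕ} {s : ℝ}

theorem gaussKernel_pos (hs : 0 < s) (m y : Vec d) : 0 < gaussKernel s m y := by
  unfold gaussKernel; positivity

theorem gaussKernel_le (hs : 0 < s) (m y : Vec d) :
    gaussKernel s m y ≤ (2 * Real.pi * s ^ 2) ^ (-(d : ℝ) / 2) := by
  unfold gaussKernel
  refine mul_le_of_le_one_right (by positivity) (Real.exp_le_one_iff.mpr ?_)
  rw [neg_div, neg_nonpos]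
  positivity

theorem measurable_gaussKernel {α : Type*} [MeasurableSpace α] {s : α → ℝ} {m y : α → Vec d}
    (hs : Measurable s) (hm : Measurable m) (hy : Measurable y) :
    Measurable fun q => gaussKernel (s q) (m q) (y q) := by
  unfold gaussKernel
  have h1 : Measurable fun q => ‖y q - m q‖ := (hy.sub hm).norm
  fun_prop

theorem integrable_gaussKernel (hs : 0 < s) (m : Vec d) : Integrable (gaussKernel s m) := by
  have h1 := GaussianFourier.integrable_cexp_neg_mul_sq_norm_add (V := Vec d)
    (b := ((2 * s ^ 2)⁻¹ : ℝ)) (by rw [Complex.ofReal_re]; positivity) 0 0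
  have h2 := ((h1.norm.comp_sub_right m).const_mul ((2 * Real.pi * s ^ 2) ^ (-(d : ℝ) / 2)))
  refine h2.congr (Filter.Eventually.of_forall fun y => ?_)
  simp only [gaussKernel, Complex.norm_exp]
  congr 2
  simp [← Complex.ofReal_pow, ← Complex.ofReal_mul]
  ring

/-- The Gaussian law `N(m, s² I)` has density `gaussKernel s m`; both sides have the same
characteristic function. -/
theorem map_stdGaussian_affine (hs : 0 < s) (m : Vec d) :
    (stdGaussian (Vec d)).map (fun z => m + s • z) =
      volume.withDensity fun y => ENNReal.ofReal (gaussKernel s m y) := by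
  have hmeas : Measurable fun z : Vec d => m + s • z := by fun_prop
  have : IsProbabilityMeasure ((stdGaussian (Vec d)).map (fun z => m + s • z)) :=
    Measure.isProbabilityMeasure_map hmeas.aemeasurable
  have hk : Measurable (gaussKernel s m) :=
    measurable_gaussKernel measurable_const measurable_const measurable_id
  have : IsFiniteMeasure (volume.withDensity fun y => ENNReal.ofReal (gaussKernel s m y)) :=
    isFiniteMeasure_withDensity_ofReal (integrable_gaussKernel hs m).2
  refine Measure.ext_of_charFun (funext fun t => ?_)
  have e1 : charFun ((stdGaussian (Vec d)).map (fun z => m + s • z)) t =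
      Complex.exp (inner ℝ m t * Complex.I) * Complex.exp (-(s ^ 2 * ‖t‖ ^ 2 / 2)) := by
    rw [charFun_apply, integral_map hmeas.aemeasurable (by fun_prop)]
    have : ∀ z : Vec d, Complex.exp (inner ℝ (m + s • z) t * Complex.I) =
        Complex.exp (inner ℝ m t * Complex.I) *
          Complex.exp (inner ℝ z (s • t) * Complex.I) := by
      intro z
      rw [← Complex.exp_add, inner_add_left, inner_smul_left, inner_smul_right]
      simp; ring_nf
    simp_rw [this]
    rw [integral_const_mul, ← charFun_apply, charFun_stdGaussian, norm_smul, Real.norm_eq_abs]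
    congr 2
    have : ((|s| * ‖t‖ : ℝ) : ℂ) ^ 2 = s ^ 2 * ‖t‖ ^ 2 := by
      rw [← Complex.ofReal_pow, mul_pow, sq_abs]; push_cast; ring
    rw [this]; ring
  have e2 : charFun (volume.withDensity fun y => ENNReal.ofReal (gaussKernel s m y)) t =
      Complex.exp (inner ℝ m t * Complex.I) * Complex.exp (-(s ^ 2 * ‖t‖ ^ 2 / 2)) := by
    rw [charFun_apply, integral_withDensity_eq_integral_toReal_smul (by fun_prop)
      (Filter.Eventually.of_forall fun _ => ENNReal.ofReal_lt_top)]
    set Φ : Vec d → ℂ := fun u => (((2 * Real.pi * s ^ 2) ^ (-(d : ℝ) / 2) : ℝ) : ℂ) *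
      Complex.exp (inner ℝ m t * Complex.I) *
      Complex.exp (-((2 * s ^ 2)⁻¹ : ℝ) * ‖u‖ ^ 2 + Complex.I * inner ℝ t u) with hΦ
    have h1 : ∀ y : Vec d, (ENNReal.ofReal (gaussKernel s m y)).toReal •
        Complex.exp (inner ℝ y t * Complex.I) = Φ (y - m) := by
      intro y
      have h0 : Complex.exp ((-‖y - m‖ ^ 2 / (2 * s ^ 2) : ℝ) : ℂ) *
          Complex.exp (inner ℝ y t * Complex.I) = Complex.exp (inner ℝ m t * Complex.I) *
          Complex.exp (-((2 * s ^ 2)⁻¹ : ℝ) * ‖y - m‖ ^ 2 +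
            Complex.I * inner ℝ t (y - m)) := by
        rw [← Complex.exp_add, ← Complex.exp_add, inner_sub_right, real_inner_comm y t,
          real_inner_comm m t]
        congr 1
        push_cast
        ring
      rw [ENNReal.toReal_ofReal (gaussKernel_pos hs m y).le, gaussKernel, Complex.real_smul,
        Complex.ofReal_mul, Complex.ofReal_exp, mul_assoc, h0, ← mul_assoc]
    rw [integral_congr_ae (Filter.Eventually.of_forall h1), integral_sub_right_eq_self Φ m, hΦ,
      integral_const_mul, GaussianFourier.integral_cexp_neg_mul_sq_norm_add
        (by rw [Complex.ofReal_re]; positivity)]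
    have h2 : ((Real.pi : ℂ) / ((2 * s ^ 2)⁻¹ : ℝ)) ^ (Module.finrank ℝ (Vec d) / 2 : ℂ) =
        (((2 * Real.pi * s ^ 2) ^ ((d : ℝ) / 2) : ℝ) : ℂ) := by
      rw [Complex.ofReal_cpow (by positivity)]
      simp only [finrank_euclideanSpace, Fintype.card_fin]
      push_cast
      congr 1
      field_simp
    have h3 : (((2 * Real.pi * s ^ 2) ^ (-(d : ℝ) / 2) : ℝ) : ℂ) *
        (((2 * Real.pi * s ^ 2) ^ ((d : ℝ) / 2) : ℝ) : ℂ) = 1 := by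
      rw [← Complex.ofReal_mul, ← Real.rpow_add (by positivity)]
      simp [neg_div]
    have h4 : Complex.I ^ 2 * (‖t‖ : ℂ) ^ 2 / (4 * (((2 * s ^ 2)⁻¹ : ℝ) : ℂ)) =
        -(s ^ 2 * ‖t‖ ^ 2 / 2) := by
      have : (s : ℂ) ≠ 0 := by exact_mod_cast hs.ne'
      rw [Complex.I_sq]
      push_cast
      field_simp
      norm_num
    rw [h2, h4]
    calc _ = ((((2 * Real.pi * s ^ 2) ^ (-(d : ℝ) / 2) : ℝ) : ℂ) *
        (((2 * Real.pi * s ^ 2) ^ ((d : ℝ) / 2) : ℝ) : ℂ)) *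
          (Complex.exp (inner ℝ m t * Complex.I) * Complex.exp (-(s ^ 2 * ‖t‖ ^ 2 / 2))) := by ring
      _ = _ := by rw [h3, one_mul]
  rw [e1, e2]

/-- The joint law of `(X, r X + s Z)` with `Z` standard Gaussian and independent of `X ∼ μ`. -/
theorem map_prod_stdGaussian (hs : 0 < s) (r : ℝ) (μ : Measure (Vec d)) [SFinite μ] :
    (μ.prod (stdGaussian (Vec d))).map (fun q => (q.1, r • q.1 + s • q.2)) =
      (μ.prod volume).withDensity fun q => ENNReal.ofReal (gaussKernel s (r • q.1) q.2) := by
  have hT : Measurable fun q : Vec d × Vec d => (q.1, r • q.1 + s • q.2) := by fun_prop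
  have hk : Measurable fun q : Vec d × Vec d => ENNReal.ofReal (gaussKernel s (r • q.1) q.2) :=
    (measurable_gaussKernel measurable_const (by fun_prop) measurable_snd).ennreal_ofReal
  refine Measure.ext_of_lintegral _ fun f hf => ?_
  have hfT : Measurable fun q : Vec d × Vec d => f (q.1, r • q.1 + s • q.2) := hf.comp hT
  rw [lintegral_map hf hT, lintegral_prod _ hfT.aemeasurable,
    lintegral_withDensity_eq_lintegral_mul _ hk hf,
    lintegral_prod _ (hk.mul hf).aemeasurable]
  congr 1 with x
  have hfx : Measurable fun y => f (x, y) := by fun_prop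
  have hkx : Measurable fun y : Vec d => ENNReal.ofReal (gaussKernel s (r • x) y) :=
    (measurable_gaussKernel measurable_const measurable_const measurable_id).ennreal_ofReal
  rw [← lintegral_map (μ := stdGaussian (Vec d)) (f := fun y => f (x, y)) hfx
    (g := fun z => r • x + s • z) (by fun_prop), map_stdGaussian_affine hs,
    lintegral_withDensity_eq_lintegral_mul _ hkx hfx]
  rfl

end Kernel

/-! ### Gaussian mixtures and Tweedie's formula -/

/-- The density of the law of `r X + s Z`, with `Z` standard Gaussian and independent of
`X ∼ μ`. -/
noncomputable def gaussMix {d : ℕ} (s r : ℝ) (μ : Measure (Vec d)) (y : Vec d) : ℝ :=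
  ∫ x, gaussKernel s (r • x) y ∂μ

/-- The value of `Z / s` on the event `X = x`, `r X + s Z = y`. -/
noncomputable def residual {d : ℕ} (s r : ℝ) (y x : Vec d) : Vec d :=
  (s ^ 2)⁻¹ • (y - r • x)

/-- Tweedie's expression for the score of a Gaussian mixture: the conditional mean of `-Z / s`
given `r X + s Z = y`. -/
noncomputable def tweedie {d : ℕ} (s r : ℝ) (μ : Measure (Vec d)) (y : Vec d) : Vec d :=
  -((gaussMix s r μ y)⁻¹ • ∫ x, gaussKernel s (r • x) y • residual s r y x ∂μ)

section Mixture

variable {d : ℕ} {s r : ℝ} {μ : Measure (Vec d)}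

theorem measurable_residual {α : Type*} [MeasurableSpace α] {s r : α → ℝ} {y x : α → Vec d}
    (hs : Measurable s) (hr : Measurable r) (hy : Measurable y) (hx : Measurable x) :
    Measurable fun q => residual (s q) (r q) (y q) (x q) := by
  unfold residual
  fun_prop

theorem gaussKernel_mul_norm_residual_sq_le (hs : 0 < s) (r : ℝ) (y x : Vec d) :
    gaussKernel s (r • x) y * ‖residual s r y x‖ ^ 2 ≤
      (2 * Real.pi * s ^ 2) ^ (-(d : ℝ) / 2) * (2 * (s ^ 2)⁻¹) := by
  rw [gaussKernel, residual, norm_smul, mul_assoc]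
  refine mul_le_mul_of_nonneg_left ?_ (by positivity)
  rw [Real.norm_of_nonneg (by positivity), mul_pow]
  set u := ‖y - r • x‖ ^ 2 with hu
  have h1 := Real.add_one_le_exp (u / (2 * s ^ 2))
  have h2 : Real.exp (-u / (2 * s ^ 2)) * (u / (2 * s ^ 2)) ≤ 1 := by
    rw [neg_div, Real.exp_neg, inv_mul_le_one₀ (Real.exp_pos _)]
    linarith
  calc Real.exp (-u / (2 * s ^ 2)) * ((s ^ 2)⁻¹ ^ 2 * u)
      = 2 * (s ^ 2)⁻¹ * (Real.exp (-u / (2 * s ^ 2)) * (u / (2 * s ^ 2))) := by field_simp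
    _ ≤ 2 * (s ^ 2)⁻¹ * 1 := by gcongr
    _ = _ := mul_one _

theorem norm_gaussKernel_smul_residual_le (hs : 0 < s) (r : ℝ) (y x : Vec d) :
    ‖gaussKernel s (r • x) y • residual s r y x‖ ≤
      (2 * Real.pi * s ^ 2) ^ (-(d : ℝ) / 2) * (1 + 2 * (s ^ 2)⁻¹) := by
  have hk := gaussKernel_pos hs (r • x) y
  rw [norm_smul, Real.norm_of_nonneg hk.le]
  have h1 := gaussKernel_mul_norm_residual_sq_le hs r y x
  have h2 := gaussKernel_le hs (r • x) y
  have h3 : ‖residual s r y x‖ ≤ 1 + ‖residual s r y x‖ ^ 2 := by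
    nlinarith [sq_nonneg (‖residual s r y x‖ - 1), norm_nonneg (residual s r y x)]
  have h4 := mul_le_mul_of_nonneg_left h3 hk.le
  linarith

theorem hasFDerivAt_gaussKernel (r : ℝ) (x y : Vec d) :
    HasFDerivAt (gaussKernel s (r • x))
      (innerSL ℝ (-(gaussKernel s (r • x) y • residual s r y x))) y := by
  have h1 : HasFDerivAt (fun y : Vec d => ‖y - r • x‖ ^ 2) ((2 : ℝ) • innerSL ℝ (y - r • x)) y := by
    have := (hasStrictFDerivAt_norm_sq (y - r • x)).hasFDerivAt.comp y
      ((hasFDerivAt_id y).sub_const (r • x))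
    simpa [Function.comp_def, two_smul] using this
  have h2 : HasFDerivAt (fun y : Vec d => -‖y - r • x‖ ^ 2 / (2 * s ^ 2))
      ((2 * s ^ 2)⁻¹ • -((2 : ℝ) • innerSL ℝ (y - r • x))) y := by
    have := h1.fun_neg.const_smul (2 * s ^ 2)⁻¹
    refine this.congr_of_eventuallyEq (Filter.Eventually.of_forall fun z => ?_)
    simp only [Pi.smul_apply, smul_eq_mul]
    ring
  have h3 := (h2.exp).const_mul ((2 * Real.pi * s ^ 2) ^ (-(d : ℝ) / 2))
  refine h3.congr_fderiv ?_
  ext v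
  simp only [residual, gaussKernel, map_neg, map_smul, _root_.smul_apply,
    _root_.neg_apply, innerSL_apply_apply, smul_eq_mul]
  by_cases hs : s = 0
  · simp [hs]
  · field_simp

variable [IsProbabilityMeasure μ]

theorem measurable_gaussKernel_left (s r : ℝ) (y : Vec d) :
    Measurable fun x => gaussKernel s (r • x) y :=
  measurable_gaussKernel measurable_const (by fun_prop) measurable_const

theorem integrable_gaussKernel_left (hs : 0 < s) (r : ℝ) (y : Vec d) :
    Integrable (fun x => gaussKernel s (r • x) y) μ :=
  Integrable.of_bound (measurable_gaussKernel_left s r y).aestronglyMeasurable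
    ((2 * Real.pi * s ^ 2) ^ (-(d : ℝ) / 2)) (Filter.Eventually.of_forall fun x => by
      rw [Real.norm_of_nonneg (gaussKernel_pos hs _ y).le]; exact gaussKernel_le hs _ y)

theorem measurable_gaussKernel_smul_residual (s r : ℝ) (y : Vec d) :
    Measurable fun x => gaussKernel s (r • x) y • residual s r y x :=
  (measurable_gaussKernel_left s r y).smul
    (measurable_residual measurable_const measurable_const measurable_const measurable_id)

theorem integrable_gaussKernel_smul_residual (hs : 0 < s) (r : ℝ) (y : Vec d) :
    Integrable (fun x => gaussKernel s (r • x) y • residual s r y x) μ :=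
  Integrable.of_bound (measurable_gaussKernel_smul_residual s r y).aestronglyMeasurable _
    (Filter.Eventually.of_forall fun x => norm_gaussKernel_smul_residual_le hs r y x)

theorem gaussMix_pos (hs : 0 < s) (r : ℝ) (y : Vec d) : 0 < gaussMix s r μ y := by
  rw [gaussMix, integral_pos_iff_support_of_nonneg
    (fun x => (gaussKernel_pos hs _ y).le) (integrable_gaussKernel_left hs r y)]
  have : (Function.support fun x => gaussKernel s (r • x) y) = univ :=
    eq_univ_of_forall fun x => (gaussKernel_pos hs _ y).ne'
  rw [this]
  simp

theorem ofReal_gaussMix (hs : 0 < s) (r : ℝ) (y : Vec d) :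
    ENNReal.ofReal (gaussMix s r μ y) = ∫⁻ x, ENNReal.ofReal (gaussKernel s (r • x) y) ∂μ :=
  ofReal_integral_eq_lintegral_ofReal (integrable_gaussKernel_left hs r y)
    (Filter.Eventually.of_forall fun _ => (gaussKernel_pos hs _ y).le)

theorem hasFDerivAt_gaussMix (hs : 0 < s) (r : ℝ) (y : Vec d) :
    HasFDerivAt (gaussMix s r μ)
      (innerSL ℝ (-∫ x, gaussKernel s (r • x) y • residual s r y x ∂μ)) y := by
  have h := hasFDerivAt_integral_of_dominated_of_fderiv_le (μ := μ) (𝕜 := ℝ)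
    (F := fun y x => gaussKernel s (r • x) y)
    (F' := fun y x => innerSL ℝ (-(gaussKernel s (r • x) y • residual s r y x)))
    (x₀ := y) (s := univ)
    (bound := fun _ => (2 * Real.pi * s ^ 2) ^ (-(d : ℝ) / 2) * (1 + 2 * (s ^ 2)⁻¹))
    Filter.univ_mem
    (Filter.Eventually.of_forall fun y =>
      (measurable_gaussKernel_left s r y).aestronglyMeasurable)
    (integrable_gaussKernel_left hs r y)
    (((innerSL ℝ).continuous.measurable.comp
      (measurable_gaussKernel_smul_residual s r y).neg).aestronglyMeasurable)
    (Filter.Eventually.of_forall fun x y _ => by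
      rw [innerSL_apply_norm, norm_neg]; exact norm_gaussKernel_smul_residual_le hs r y x)
    (integrable_const _)
    (Filter.Eventually.of_forall fun x y _ => hasFDerivAt_gaussKernel r x y)
  refine h.congr_fderiv ?_
  rw [← integral_neg]
  exact (innerSL ℝ).integral_comp_comm (integrable_gaussKernel_smul_residual hs r y).neg

/-- **Tweedie's formula.** -/
theorem gradient_log_gaussMix (hs : 0 < s) (r : ℝ) (y : Vec d) :
    gradient (fun z => Real.log (gaussMix s r μ z)) y = tweedie s r μ y := by
  have h := (hasFDerivAt_gaussMix (μ := μ) hs r y).log (gaussMix_pos hs r y).ne'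
  refine HasGradientAt.gradient ?_
  rw [hasGradientAt_iff_hasFDerivAt]
  refine h.congr_fderiv ?_
  ext v
  simp [tweedie]

theorem gaussMix_smul_tweedie (hs : 0 < s) (r : ℝ) (y : Vec d) :
    gaussMix s r μ y • tweedie s r μ y =
      -∫ x, gaussKernel s (r • x) y • residual s r y x ∂μ := by
  rw [tweedie, smul_neg, smul_smul, mul_inv_cancel₀ (gaussMix_pos hs r y).ne', one_smul]

theorem measurable_gaussMix {α : Type*} [MeasurableSpace α] {s r : α → ℝ} {y : α → Vec d}
    (hs : Measurable s) (hr : Measurable r) (hy : Measurable y) :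
    Measurable fun q => gaussMix (s q) (r q) μ (y q) := by
  have h : Measurable fun q : α × Vec d => gaussKernel (s q.1) (r q.1 • q.2) (y q.1) :=
    measurable_gaussKernel (by fun_prop) (by fun_prop) (by fun_prop)
  exact h.stronglyMeasurable.integral_prod_right'.measurable

theorem measurable_tweedie {α : Type*} [MeasurableSpace α] {s r : α → ℝ} {y : α → Vec d}
    (hs : Measurable s) (hr : Measurable r) (hy : Measurable y) :
    Measurable fun q => tweedie (s q) (r q) μ (y q) := by
  have h : Measurable fun q : α × Vec d =>
      gaussKernel (s q.1) (r q.1 • q.2) (y q.1) • residual (s q.1) (r q.1) (y q.1) q.2 :=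
    (measurable_gaussKernel (by fun_prop) (by fun_prop) (by fun_prop)).smul
      (measurable_residual (by fun_prop) (by fun_prop) (by fun_prop) (by fun_prop))
  exact ((measurable_gaussMix hs hr hy).inv.smul
    h.stronglyMeasurable.integral_prod_right'.measurable).neg

/-- Disintegration of the law of `(X, r X + s Z)` along its second component. -/
theorem lintegral_prod_stdGaussian (hs : 0 < s) (r : ℝ) {f : Vec d × Vec d → ℝ≥0∞}
    (hf : Measurable f) :
    ∫⁻ x, ∫⁻ z, f (x, r • x + s • z) ∂(stdGaussian (Vec d)) ∂μ =
      ∫⁻ y, ∫⁻ x, ENNReal.ofReal (gaussKernel s (r • x) y) * f (x, y) ∂μ := by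
  have hT : Measurable fun q : Vec d × Vec d => (q.1, r • q.1 + s • q.2) := by fun_prop
  have hfT : Measurable fun q : Vec d × Vec d => f (q.1, r • q.1 + s • q.2) := hf.comp hT
  have hk : Measurable fun q : Vec d × Vec d => ENNReal.ofReal (gaussKernel s (r • q.1) q.2) :=
    (measurable_gaussKernel measurable_const (by fun_prop) measurable_snd).ennreal_ofReal
  have h1 := lintegral_map (μ := μ.prod (stdGaussian (Vec d))) hf hT
  rw [map_prod_stdGaussian hs, lintegral_withDensity_eq_lintegral_mul _ hk hf,
    lintegral_prod_symm _ (hk.mul hf).aemeasurable, lintegral_prod _ hfT.aemeasurable] at h1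
  exact h1.symm

/-- `r X + s Z` has density `gaussMix s r μ`. -/
theorem lintegral_stdGaussian_mix (hs : 0 < s) (r : ℝ) {f : Vec d → ℝ≥0∞} (hf : Measurable f) :
    ∫⁻ x, ∫⁻ z, f (r • x + s • z) ∂(stdGaussian (Vec d)) ∂μ =
      ∫⁻ y, ENNReal.ofReal (gaussMix s r μ y) * f y := by
  rw [lintegral_prod_stdGaussian hs r (f := fun q => f q.2) (hf.comp measurable_snd)]
  congr 1 with y
  dsimp only
  rw [lintegral_mul_const _ (measurable_gaussKernel_left s r y).ennreal_ofReal,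
    ofReal_gaussMix hs]

theorem residual_affine (hs : 0 < s) (r : ℝ) (x z : Vec d) :
    residual s r (r • x + s • z) x = s⁻¹ • z := by
  rw [residual, add_sub_cancel_left, smul_smul]
  congr 1
  field_simp

/-- Tweedie's formula in weak form: `tweedie + Z / s` is orthogonal to every function of
`r X + s Z`. -/
theorem integral_inner_tweedie_add_eq_zero (hs : 0 < s) (r : ℝ) {F : Vec d → Vec d}
    (hF : Measurable F)
    (hint : Integrable (fun q : Vec d × Vec d =>
      inner ℝ (F (r • q.1 + s • q.2)) (tweedie s r μ (r • q.1 + s • q.2) + s⁻¹ • q.2))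
      (μ.prod (stdGaussian (Vec d)))) :
    ∫ q : Vec d × Vec d,
      inner ℝ (F (r • q.1 + s • q.2)) (tweedie s r μ (r • q.1 + s • q.2) + s⁻¹ • q.2)
      ∂(μ.prod (stdGaussian (Vec d))) = 0 := by
  set T : Vec d × Vec d → Vec d × Vec d := fun q => (q.1, r • q.1 + s • q.2) with hTdef
  have hT : Measurable T := by fun_prop
  set f : Vec d × Vec d → ℝ := fun q =>
    inner ℝ (F q.2) (tweedie s r μ q.2 + residual s r q.2 q.1) with hf
  have hfm : Measurable f :=
    (hF.comp measurable_snd).inner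
      ((measurable_tweedie measurable_const measurable_const measurable_snd).add
        (measurable_residual measurable_const measurable_const measurable_snd measurable_fst))
  have hfT : ∀ q : Vec d × Vec d, f (T q) =
      inner ℝ (F (r • q.1 + s • q.2)) (tweedie s r μ (r • q.1 + s • q.2) + s⁻¹ • q.2) := by
    intro q
    simp only [hf, hTdef, residual_affine hs]
  simp_rw [← hfT] at hint ⊢
  have hk : Measurable fun q : Vec d × Vec d => ENNReal.ofReal (gaussKernel s (r • q.1) q.2) :=
    (measurable_gaussKernel measurable_const (by fun_prop) measurable_snd).ennreal_ofReal
  have hktop : ∀ᵐ q : Vec d × Vec d ∂(μ.prod volume),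
      ENNReal.ofReal (gaussKernel s (r • q.1) q.2) < ∞ :=
    Filter.Eventually.of_forall fun _ => ENNReal.ofReal_lt_top
  have hI : Integrable f ((μ.prod (stdGaussian (Vec d))).map T) :=
    (integrable_map_measure hfm.aestronglyMeasurable hT.aemeasurable).mpr hint
  rw [← integral_map hT.aemeasurable hfm.aestronglyMeasurable, hTdef, map_prod_stdGaussian hs,
    integral_withDensity_eq_integral_toReal_smul hk hktop]
  rw [hTdef, map_prod_stdGaussian hs, integrable_withDensity_iff_integrable_smul' hk hktop] at hI
  rw [integral_prod_symm _ hI]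
  refine integral_eq_zero_of_ae (Filter.Eventually.of_forall fun y => ?_)
  have h1 : ∀ x, (ENNReal.ofReal (gaussKernel s (r • x) y)).toReal • f (x, y) =
      inner ℝ (F y) (gaussKernel s (r • x) y • tweedie s r μ y +
        gaussKernel s (r • x) y • residual s r y x) := by
    intro x
    rw [ENNReal.toReal_ofReal (gaussKernel_pos hs _ y).le, ← smul_add, inner_smul_right,
      smul_eq_mul]
  simp only [h1, Pi.zero_apply]
  have h2 : Integrable (fun x => gaussKernel s (r • x) y • tweedie s r μ y) μ :=
    (integrable_gaussKernel_left hs r y).smul_const _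
  have h3 := integrable_gaussKernel_smul_residual (μ := μ) hs r y
  have h4 := integral_inner (𝕜 := ℝ) (h2.add h3) (F y)
  simp only [Pi.add_apply] at h4
  rw [h4, integral_add h2 h3, integral_smul_const]
  change inner ℝ (F y) (gaussMix s r μ y • tweedie s r μ y + _) = 0
  rw [gaussMix_smul_tweedie hs, neg_add_cancel, inner_zero_right]

/-- Conditional Jensen inequality for the posterior law of `X` given `r X + s Z = y`. -/
theorem ofReal_gaussMix_mul_exp_tweedie_le (hs : 0 < s) (r : ℝ) (y : Vec d) {k : ℝ}
    (hk : 0 ≤ k) :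
    ENNReal.ofReal (gaussMix s r μ y) * ENNReal.ofReal (Real.exp (k * ‖tweedie s r μ y‖ ^ 2)) ≤
      ∫⁻ x, ENNReal.ofReal (gaussKernel s (r • x) y) *
        ENNReal.ofReal (Real.exp (k * ‖residual s r y x‖ ^ 2)) ∂μ := by
  set κ : Vec d → ℝ≥0∞ := fun x => ENNReal.ofReal (gaussKernel s (r • x) y) with hκ
  have hκm : Measurable κ := (measurable_gaussKernel_left s r y).ennreal_ofReal
  have hκtop : ∀ᵐ x ∂μ, κ x < ∞ := Filter.Eventually.of_forall fun _ => ENNReal.ofReal_lt_top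
  have hκr : ∀ x, (κ x).toReal = gaussKernel s (r • x) y := fun x =>
    ENNReal.toReal_ofReal (gaussKernel_pos hs _ y).le
  have hM := gaussMix_pos (μ := μ) hs r y
  set M := gaussMix s r μ y with hMdef
  have hM0 : ENNReal.ofReal M ≠ 0 := by simpa using hM
  -- The posterior law of `X`.
  set ν : Measure (Vec d) := (ENNReal.ofReal M)⁻¹ • μ.withDensity κ with hν
  have : IsProbabilityMeasure ν := ⟨by
    rw [hν, Measure.smul_apply, withDensity_apply _ MeasurableSet.univ, Measure.restrict_univ,
      ← ofReal_gaussMix hs, smul_eq_mul, ENNReal.inv_mul_cancel hM0 ENNReal.ofReal_ne_top]⟩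
  have hres : Measurable fun x => residual s r y x :=
    measurable_residual measurable_const measurable_const measurable_const measurable_id
  have htw : tweedie s r μ y = -∫ x, residual s r y x ∂ν := by
    rw [hν, integral_smul_measure, integral_withDensity_eq_integral_toReal_smul hκm hκtop,
      tweedie]
    simp only [hκr, ENNReal.toReal_inv, ENNReal.toReal_ofReal hM.le]
    rfl
  have hres2 : Integrable (fun x => ‖residual s r y x‖ ^ 2) ν := by
    rw [hν]
    refine Integrable.smul_measure ?_ (ENNReal.inv_ne_top.mpr hM0)
    rw [integrable_withDensity_iff_integrable_smul' hκm hκtop]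
    refine Integrable.of_bound (by fun_prop)
      ((2 * Real.pi * s ^ 2) ^ (-(d : ℝ) / 2) * (2 * (s ^ 2)⁻¹))
      (Filter.Eventually.of_forall fun x => ?_)
    rw [hκr, smul_eq_mul, Real.norm_of_nonneg
      (mul_nonneg (gaussKernel_pos hs _ y).le (sq_nonneg _))]
    exact gaussKernel_mul_norm_residual_sq_le hs r y x
  have hmem : MemLp (residual s r y) 2 ν :=
    (memLp_two_iff_integrable_sq_norm hres.aestronglyMeasurable).mpr hres2
  have hsq : ‖tweedie s r μ y‖ ^ 2 ≤ ∫ x, ‖residual s r y x‖ ^ 2 ∂ν := by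
    rw [htw, norm_neg]
    have h1 := sq_integral_inner_le hmem.norm (memLp_const (1 : ℝ) (μ := ν))
    simp only [norm_norm, norm_one, one_pow, integral_const, probReal_univ, smul_eq_mul,
      mul_one] at h1
    refine le_trans ?_ h1
    gcongr
    refine (norm_integral_le_integral_norm _).trans_eq ?_
    simp
  have h2 : ENNReal.ofReal (Real.exp (k * ‖tweedie s r μ y‖ ^ 2)) ≤
      ∫⁻ x, ENNReal.ofReal (Real.exp (k * ‖residual s r y x‖ ^ 2)) ∂ν := by
    refine le_trans ?_ (ofReal_exp_integral_le (ν := ν) fun x => by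
      simp only [Pi.zero_apply]; positivity)
    rw [integral_const_mul]
    gcongr
  rw [hν, lintegral_smul_measure, lintegral_withDensity_eq_lintegral_mul _ hκm (by fun_prop),
    smul_eq_mul] at h2
  calc _ ≤ ENNReal.ofReal M * ((ENNReal.ofReal M)⁻¹ * _) := by gcongr
    _ = _ := by
      rw [← mul_assoc, ENNReal.mul_inv_cancel hM0 ENNReal.ofReal_ne_top, one_mul]
      rfl

/-- The score at `r X + s Z` inherits the exponential moments of `Z / s`. -/
theorem lintegral_exp_tweedie_le (hs : 0 < s) (r : ℝ) {k : ℝ} (hk : 0 ≤ k) :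
    ∫⁻ x, ∫⁻ z, ENNReal.ofReal (Real.exp (k * ‖tweedie s r μ (r • x + s • z)‖ ^ 2))
        ∂(stdGaussian (Vec d)) ∂μ ≤
      ∫⁻ z, ENNReal.ofReal (Real.exp (k * ‖s⁻¹ • z‖ ^ 2)) ∂(stdGaussian (Vec d)) := by
  have hm : Measurable fun y => tweedie s r μ y :=
    measurable_tweedie measurable_const measurable_const measurable_id
  have hres : Measurable fun q : Vec d × Vec d => residual s r q.2 q.1 :=
    measurable_residual measurable_const measurable_const measurable_snd measurable_fst
  rw [lintegral_stdGaussian_mix hs r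
    (f := fun y => ENNReal.ofReal (Real.exp (k * ‖tweedie s r μ y‖ ^ 2))) (by fun_prop)]
  refine (lintegral_mono fun y => ofReal_gaussMix_mul_exp_tweedie_le hs r y hk).trans_eq ?_
  rw [← lintegral_prod_stdGaussian hs r
    (f := fun q => ENNReal.ofReal (Real.exp (k * ‖residual s r q.2 q.1‖ ^ 2))) (by fun_prop)]
  simp only [residual_affine hs, lintegral_const, measure_univ, mul_one]

end Mixture

section Marginal

variable {d : ℕ} {σ t : ℝ} {p : Vec d → ℝ}

theorem noise_pos (hσ : 0 < σ) (ht : 0 < t) : 0 < noise σ t := by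
  have : Real.exp (-2 * t) < 1 := by rw [Real.exp_lt_one_iff]; linarith
  exact mul_pos (Real.sqrt_pos.mpr (by linarith)) hσ

theorem noise_sq (ht : 0 ≤ t) : noise σ t ^ 2 = σ ^ 2 * (1 - Real.exp (-2 * t)) := by
  have : Real.exp (-2 * t) ≤ 1 := Real.exp_le_one_iff.mpr (by linarith)
  rw [noise, mul_pow, Real.sq_sqrt (by linarith), mul_comm]

theorem noise_mono (hσ : 0 ≤ σ) {t' : ℝ} (h : t ≤ t') : noise σ t ≤ noise σ t' := by
  have h1 : Real.exp (-2 * t') ≤ Real.exp (-2 * t) := Real.exp_le_exp.mpr (by linarith)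
  unfold noise
  gcongr

@[fun_prop]
theorem measurable_noise (σ : ℝ) : Measurable (noise σ) := by
  unfold noise
  fun_prop

theorem isProbabilityMeasure_law (hp : IsProbDensity p) : IsProbabilityMeasure (law p) :=
  ⟨by rw [law, withDensity_apply _ MeasurableSet.univ, Measure.restrict_univ,
    hp.lintegral_eq_one]⟩

theorem marginal_eq_gaussMix (hp : IsProbDensity p) (y : Vec d) :
    marginal σ p t y = gaussMix (noise σ t) (Real.exp (-t)) (law p) y := by
  rw [gaussMix, law, integral_withDensity_eq_integral_toReal_smul hp.measurable.ennreal_ofReal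
    (Filter.Eventually.of_forall fun _ => ENNReal.ofReal_lt_top), marginal]
  congr 1 with x
  rw [ENNReal.toReal_ofReal (hp.nonneg x), smul_eq_mul, mul_comm (p x), gaussKernel]

theorem score_eq_tweedie (hσ : 0 < σ) (hp : IsProbDensity p) (ht : 0 < t) (y : Vec d) :
    score σ p t y = tweedie (noise σ t) (Real.exp (-t)) (law p) y := by
  have := isProbabilityMeasure_law hp
  rw [score, ← gradient_log_gaussMix (noise_pos hσ ht)]
  simp_rw [marginal_eq_gaussMix hp]

end Marginal

/-! ### The excess risk of denoising score matching -/

/-- The law `dt ⊗ N(0, I)` on `[τ₀, τ₁] × ℝ^d` over which the loss integrates. -/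
noncomputable def lossMeasure (d : ℕ) (τ₀ τ₁ : ℝ) : Measure (ℝ × Vec d) :=
  (volume.restrict (Icc τ₀ τ₁)).prod (stdGaussian (Vec d))

/-- The noised observation `e^{-t} x + σ_t z` at `w = (t, z)`. -/
noncomputable def noised {d : ℕ} (σ : ℝ) (x : Vec d) (w : ℝ × Vec d) : Vec d :=
  Real.exp (-w.1) • x + noise σ w.1 • w.2

/-- The score at the noised observation, in Tweedie's form. -/
noncomputable def scoreAt {d : ℕ} (σ : ℝ) (p : Vec d → ℝ) (x : Vec d) (w : ℝ × Vec d) : Vec d :=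
  tweedie (noise σ w.1) (Real.exp (-w.1)) (law p) (noised σ x w)

/-- The rescaled noise `z / σ_t` at `w = (t, z)`. -/
noncomputable def scaledNoise {d : ℕ} (σ : ℝ) (w : ℝ × Vec d) : Vec d :=
  (noise σ w.1)⁻¹ • w.2

/-- The excess loss of `s` over the true score. -/
noncomputable def excessLoss {d : ℕ} (σ τ₀ τ₁ : ℝ) (p : Vec d → ℝ) (s : ℝ → Vec d → Vec d)
    (x : Vec d) : ℝ :=
  ∫ w, ‖s w.1 (noised σ x w) + scaledNoise σ w‖ ^ 2 ∂(lossMeasure d τ₀ τ₁) -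
    ∫ w, ‖scoreAt σ p x w + scaledNoise σ w‖ ^ 2 ∂(lossMeasure d τ₀ τ₁)

/-- The squared distance from `s` to the true score, averaged over the noise. -/
noncomputable def scoreDist {d : ℕ} (σ τ₀ τ₁ : ℝ) (p : Vec d → ℝ) (s : ℝ → Vec d → Vec d)
    (x : Vec d) : ℝ :=
  ∫ w, ‖s w.1 (noised σ x w) - scoreAt σ p x w‖ ^ 2 ∂(lossMeasure d τ₀ τ₁)

theorem memLp_two_of_lintegral_exp {α H : Type*} [MeasurableSpace α] {ρ : Measure α}
    [NormedAddCommGroup H] {f : α → H} (hf : AEStronglyMeasurable f ρ) {k : ℝ} (hk : 0 < k)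
    (h : ∫⁻ w, ENNReal.ofReal (Real.exp (k * ‖f w‖ ^ 2)) ∂ρ < ∞) : MemLp f 2 ρ := by
  rw [memLp_two_iff_integrable_sq_norm hf]
  have h1 : Integrable (fun w => Real.exp (k * ‖f w‖ ^ 2)) ρ := by
    refine ⟨Real.continuous_exp.comp_aestronglyMeasurable ((hf.norm.pow 2).const_mul k), ?_⟩
    rwa [hasFiniteIntegral_iff_ofReal (Filter.Eventually.of_forall fun x => (Real.exp_pos _).le)]
  refine (h1.const_mul k⁻¹).mono' (hf.norm.pow 2) (Filter.Eventually.of_forall fun w => ?_)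
  rw [Real.norm_of_nonneg (sq_nonneg _)]
  have := Real.add_one_le_exp (k * ‖f w‖ ^ 2)
  calc ‖f w‖ ^ 2 = k⁻¹ * (k * ‖f w‖ ^ 2) := by field_simp
    _ ≤ k⁻¹ * Real.exp (k * ‖f w‖ ^ 2) := by gcongr; linarith

theorem ofReal_integral_integral_eq {𝒳 W : Type*} [MeasurableSpace 𝒳] [MeasurableSpace W]
    {μ : Measure 𝒳} {ρ : Measure W} [SFinite μ] [SFinite ρ] {f : 𝒳 × W → ℝ}
    (hf : Integrable f (μ.prod ρ)) (h0 : ∀ q, 0 ≤ f q) :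
    ENNReal.ofReal (∫ x, ∫ w, f (x, w) ∂ρ ∂μ) = ∫⁻ w, ∫⁻ x, ENNReal.ofReal (f (x, w)) ∂μ ∂ρ := by
  rw [← integral_prod _ hf, ofReal_integral_eq_lintegral_ofReal hf
    (Filter.Eventually.of_forall h0),
    lintegral_prod_symm _ hf.aestronglyMeasurable.aemeasurable.ennreal_ofReal]

section Excess

variable {d : ℕ} {σ τ₀ τ₁ : ℝ} {p : Vec d → ℝ}

instance isFiniteMeasure_lossMeasure : IsFiniteMeasure (lossMeasure d τ₀ τ₁) := by
  unfold lossMeasure; infer_instance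

theorem lossMeasure_univ : lossMeasure d τ₀ τ₁ univ = ENNReal.ofReal (τ₁ - τ₀) := by
  rw [lossMeasure, ← univ_prod_univ, Measure.prod_prod]
  simp

theorem lossMeasure_real_univ (h : τ₀ ≤ τ₁) : (lossMeasure d τ₀ τ₁).real univ = τ₁ - τ₀ := by
  rw [measureReal_def, lossMeasure_univ, ENNReal.toReal_ofReal (by linarith)]

theorem ae_lossMeasure_fst_mem : ∀ᵐ w ∂(lossMeasure d τ₀ τ₁), w.1 ∈ Icc τ₀ τ₁ :=
  Measure.quasiMeasurePreserving_fst.ae (ae_restrict_mem measurableSet_Icc)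

@[fun_prop]
theorem measurable_noised {α : Type*} [MeasurableSpace α] {x : α → Vec d} {w : α → ℝ × Vec d}
    (hx : Measurable x) (hw : Measurable w) : Measurable fun q => noised σ (x q) (w q) := by
  unfold noised
  fun_prop

@[fun_prop]
theorem measurable_scaledNoise : Measurable (scaledNoise (d := d) σ) := by
  unfold scaledNoise
  fun_prop

theorem measurable_scoreAt (hp : IsProbDensity p) :
    Measurable (Function.uncurry (scoreAt σ p)) := by
  have := isProbabilityMeasure_law hp
  exact measurable_tweedie (by fun_prop) (by fun_prop) (by fun_prop)

theorem measurable_comp_noised {s : ℝ → Vec d → Vec d} (hs : Measurable (Function.uncurry s)) :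
    Measurable fun q : Vec d × (ℝ × Vec d) => s q.2.1 (noised σ q.1 q.2) :=
  hs.comp (f := fun q : Vec d × (ℝ × Vec d) => (q.2.1, noised σ q.1 q.2)) (by fun_prop)

theorem measurable_excessLoss (hp : IsProbDensity p) {s : ℝ → Vec d → Vec d}
    (hs : Measurable (Function.uncurry s)) :
    Measurable (excessLoss σ τ₀ τ₁ p s) := by
  have h1 := measurable_comp_noised (σ := σ) hs
  have h2 : Measurable fun q : Vec d × (ℝ × Vec d) => scoreAt σ p q.1 q.2 :=
    measurable_scoreAt hp
  have h3 : Measurable fun q : Vec d × (ℝ × Vec d) => scaledNoise σ q.2 := by fun_prop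
  have h4 : Measurable fun q : Vec d × (ℝ × Vec d) =>
      ‖s q.2.1 (noised σ q.1 q.2) + scaledNoise σ q.2‖ ^ 2 := by fun_prop
  have h5 : Measurable fun q : Vec d × (ℝ × Vec d) =>
      ‖scoreAt σ p q.1 q.2 + scaledNoise σ q.2‖ ^ 2 := by fun_prop
  exact h4.stronglyMeasurable.integral_prod_right'.measurable.sub
    h5.stronglyMeasurable.integral_prod_right'.measurable

theorem measurable_ofReal_sq_dist (hp : IsProbDensity p) {s : ℝ → Vec d → Vec d}
    (hs : Measurable (Function.uncurry s)) : Measurable fun q : Vec d × (ℝ × Vec d) =>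
      ENNReal.ofReal (‖s q.2.1 (noised σ q.1 q.2) - scoreAt σ p q.1 q.2‖ ^ 2) := by
  have h1 := measurable_comp_noised (σ := σ) hs
  have h2 : Measurable fun q : Vec d × (ℝ × Vec d) => scoreAt σ p q.1 q.2 :=
    measurable_scoreAt hp
  fun_prop

theorem measurable_scoreDist (hp : IsProbDensity p) {s : ℝ → Vec d → Vec d}
    (hs : Measurable (Function.uncurry s)) :
    Measurable (scoreDist σ τ₀ τ₁ p s) := by
  have h1 := measurable_comp_noised (σ := σ) hs
  have h2 : Measurable fun q : Vec d × (ℝ × Vec d) => scoreAt σ p q.1 q.2 :=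
    measurable_scoreAt hp
  have h4 : Measurable fun q : Vec d × (ℝ × Vec d) =>
      ‖s q.2.1 (noised σ q.1 q.2) - scoreAt σ p q.1 q.2‖ ^ 2 := by fun_prop
  exact h4.stronglyMeasurable.integral_prod_right'.measurable

theorem measurable_envelope (hp : IsProbDensity p) (V : ℝ) : Measurable fun x =>
    envelope (lossMeasure d τ₀ τ₁) V (scoreAt σ p x) (scaledNoise σ) := by
  have h2 : Measurable fun q : Vec d × (ℝ × Vec d) => scoreAt σ p q.1 q.2 :=
    measurable_scoreAt hp
  have h3 : Measurable fun q : Vec d × (ℝ × Vec d) => scaledNoise σ q.2 := by fun_prop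
  have h4 : Measurable fun q : Vec d × (ℝ × Vec d) =>
      ‖scoreAt σ p q.1 q.2‖ ^ 2 + ‖scaledNoise σ q.2‖ ^ 2 := by fun_prop
  exact h4.stronglyMeasurable.integral_prod_right'.measurable.const_add _

theorem ae_norm_comp_noised_le {s : ℝ → Vec d → Vec d} {V : ℝ}
    (hV : ∀ t ∈ Icc τ₀ τ₁, ∀ x, ‖s t x‖ ≤ V) (x : Vec d) :
    ∀ᵐ w ∂(lossMeasure d τ₀ τ₁), ‖s w.1 (noised σ x w)‖ ≤ V := by
  filter_upwards [ae_lossMeasure_fst_mem] with w hw using hV _ hw _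

theorem memLp_comp_noised {s : ℝ → Vec d → Vec d} {V : ℝ}
    (hs : Measurable (Function.uncurry s)) (hV : ∀ t ∈ Icc τ₀ τ₁, ∀ x, ‖s t x‖ ≤ V) (x : Vec d) :
    MemLp (fun w => s w.1 (noised σ x w)) 2 (lossMeasure d τ₀ τ₁) :=
  MemLp.of_bound
    ((measurable_comp_noised hs).comp measurable_prodMk_left).aestronglyMeasurable V
    (ae_norm_comp_noised_le hV x)

/-- The score error at a fixed time, written over the observation and the noise. -/
theorem lintegral_score_slice (hσ : 0 < σ) (hp : IsProbDensity p) {t : ℝ} (ht : 0 < t)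
    {f : Vec d → Vec d} (hf : Measurable f) :
    ∫⁻ y, ENNReal.ofReal (‖f y - score σ p t y‖ ^ 2 * marginal σ p t y) =
      ∫⁻ x, ∫⁻ z, ENNReal.ofReal (‖f (noised σ x (t, z)) - scoreAt σ p x (t, z)‖ ^ 2)
        ∂(stdGaussian (Vec d)) ∂(law p) := by
  have := isProbabilityMeasure_law hp
  set r := Real.exp (-t) with hr
  have htw : Measurable (tweedie (noise σ t) r (law p)) :=
    measurable_tweedie measurable_const measurable_const measurable_id
  have h2 := lintegral_stdGaussian_mix (μ := law p) (noise_pos hσ ht) r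
    (f := fun y => ENNReal.ofReal (‖f y - tweedie (noise σ t) r (law p) y‖ ^ 2)) (by fun_prop)
  refine Eq.trans (lintegral_congr fun y => ?_) h2.symm
  rw [score_eq_tweedie hσ hp ht, marginal_eq_gaussMix hp, mul_comm,
    ENNReal.ofReal_mul (gaussMix_pos (noise_pos hσ ht) _ _).le]

/-- Exponential moments of the rescaled noise, with a constant `c₀` for which the standard Gaussian
has exponential square moment `K`. -/
theorem lintegral_exp_inv_noise_le {c₀ K : ℝ}
    (hK : ∫⁻ z, ENNReal.ofReal (Real.exp (c₀ * ‖z‖ ^ 2)) ∂(stdGaussian (Vec d)) ≤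
      ENNReal.ofReal K) (hc₀ : 0 < c₀) (hσ : 0 < σ) (hτ₀ : 0 < τ₀) {t : ℝ} (ht : τ₀ ≤ t) :
    ∫⁻ z, ENNReal.ofReal (Real.exp (c₀ * noise σ τ₀ ^ 2 * ‖(noise σ t)⁻¹ • z‖ ^ 2))
      ∂(stdGaussian (Vec d)) ≤ ENNReal.ofReal K := by
  refine (lintegral_mono fun z => ?_).trans hK
  gcongr ENNReal.ofReal (Real.exp ?_)
  have h0 := noise_pos hσ hτ₀
  have h1 := noise_mono hσ.le ht
  have h2 := noise_pos hσ (hτ₀.trans_le ht)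
  rw [norm_smul, norm_inv, Real.norm_of_nonneg h2.le, mul_pow, inv_pow]
  calc c₀ * noise σ τ₀ ^ 2 * ((noise σ t ^ 2)⁻¹ * ‖z‖ ^ 2)
      ≤ c₀ * noise σ t ^ 2 * ((noise σ t ^ 2)⁻¹ * ‖z‖ ^ 2) := by gcongr
    _ = c₀ * ‖z‖ ^ 2 := by field_simp

theorem lintegral_lossMeasure_le {f : ℝ × Vec d → ℝ≥0∞} (hf : Measurable f) {K : ℝ≥0∞}
    (h : ∀ t ∈ Icc τ₀ τ₁, ∫⁻ z, f (t, z) ∂(stdGaussian (Vec d)) ≤ K) :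
    ∫⁻ w, f w ∂(lossMeasure d τ₀ τ₁) ≤ lossMeasure d τ₀ τ₁ univ * K := by
  rw [lossMeasure_univ, lossMeasure, lintegral_prod _ hf.aemeasurable]
  calc _ ≤ ∫⁻ _ in Icc τ₀ τ₁, K := setLIntegral_mono' measurableSet_Icc h
    _ = _ := by rw [setLIntegral_const, Real.volume_Icc, mul_comm]

section Moments

variable {c₀ K : ℝ}
  (hK : ∫⁻ z, ENNReal.ofReal (Real.exp (c₀ * ‖z‖ ^ 2)) ∂(stdGaussian (Vec d)) ≤
    ENNReal.ofReal K) (hc₀ : 0 < c₀) (hσ : 0 < σ) (hτ₀ : 0 < τ₀)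

include hK hc₀ hσ hτ₀

theorem lintegral_exp_scaledNoise_le :
    ∫⁻ w, ENNReal.ofReal (Real.exp (c₀ * noise σ τ₀ ^ 2 * ‖scaledNoise σ w‖ ^ 2))
      ∂(lossMeasure d τ₀ τ₁) ≤ lossMeasure d τ₀ τ₁ univ * ENNReal.ofReal K :=
  lintegral_lossMeasure_le (by fun_prop) fun _ ht =>
    lintegral_exp_inv_noise_le hK hc₀ hσ hτ₀ ht.1

theorem memLp_scaledNoise : MemLp (scaledNoise σ) 2 (lossMeasure d τ₀ τ₁) :=
  memLp_two_of_lintegral_exp measurable_scaledNoise.aestronglyMeasurable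
    (mul_pos hc₀ (pow_pos (noise_pos hσ hτ₀) 2))
    ((lintegral_exp_scaledNoise_le hK hc₀ hσ hτ₀).trans_lt
      (ENNReal.mul_lt_top (measure_lt_top _ _) ENNReal.ofReal_lt_top))

theorem loss_eq {s : ℝ → Vec d → Vec d} {V : ℝ} (hs : Measurable (Function.uncurry s))
    (hV : ∀ t ∈ Icc τ₀ τ₁, ∀ x, ‖s t x‖ ≤ V) (hτ : τ₀ ≤ τ₁) (x : Vec d) :
    loss σ τ₀ τ₁ s x =
      ∫ w, ‖s w.1 (noised σ x w) + scaledNoise σ w‖ ^ 2 ∂(lossMeasure d τ₀ τ₁) := by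
  have h := integrable_sq_norm_of_memLp
    ((memLp_comp_noised (σ := σ) hs hV x).add (memLp_scaledNoise (τ₁ := τ₁) hK hc₀ hσ hτ₀))
  simp only [Pi.add_apply] at h
  rw [lossMeasure] at h ⊢
  rw [integral_prod _ h, loss, intervalIntegral.integral_of_le hτ, integral_Icc_eq_integral_Ioc]
  rfl

variable (hp : IsProbDensity p)

include hp

/-- The score at a fixed time has the exponential moments of the rescaled noise. -/
theorem lintegral_exp_scoreAt_slice_le {t : ℝ} (ht : τ₀ ≤ t) :
    ∫⁻ x, ∫⁻ z, ENNReal.ofReal (Real.exp (c₀ * noise σ τ₀ ^ 2 * ‖scoreAt σ p x (t, z)‖ ^ 2))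
      ∂(stdGaussian (Vec d)) ∂(law p) ≤ ENNReal.ofReal K := by
  have := isProbabilityMeasure_law hp
  refine (lintegral_exp_tweedie_le (noise_pos hσ (hτ₀.trans_le ht)) (Real.exp (-t))
    (by positivity)).trans ?_
  exact lintegral_exp_inv_noise_le hK hc₀ hσ hτ₀ ht

theorem lintegral_exp_scoreAt_le :
    ∫⁻ w, ∫⁻ x, ENNReal.ofReal (Real.exp (c₀ * noise σ τ₀ ^ 2 * ‖scoreAt σ p x w‖ ^ 2))
      ∂(law p) ∂(lossMeasure d τ₀ τ₁) ≤ lossMeasure d τ₀ τ₁ univ * ENNReal.ofReal K := by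
  have := isProbabilityMeasure_law hp
  have hm : Measurable fun q : Vec d × (ℝ × Vec d) => scoreAt σ p q.1 q.2 :=
    measurable_scoreAt hp
  have hm2 : Measurable fun q : (ℝ × Vec d) × Vec d =>
      ENNReal.ofReal (Real.exp (c₀ * noise σ τ₀ ^ 2 * ‖scoreAt σ p q.2 q.1‖ ^ 2)) := by
    have := hm.comp (measurable_swap (α := ℝ × Vec d) (β := Vec d))
    simp only [Function.comp_def, Prod.fst_swap, Prod.snd_swap] at this
    fun_prop
  refine lintegral_lossMeasure_le hm2.lintegral_prod_right' fun t ht => ?_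
  rw [lintegral_lintegral_swap]
  · exact lintegral_exp_scoreAt_slice_le hK hc₀ hσ hτ₀ hp ht.1
  · exact (hm2.comp (f := fun q : Vec d × Vec d => ((t, q.1), q.2)) (by fun_prop)).aemeasurable

theorem memLp_scoreAt_prod :
    MemLp (Function.uncurry (scoreAt σ p)) 2 ((law p).prod (lossMeasure d τ₀ τ₁)) := by
  have := isProbabilityMeasure_law hp
  have hm := measurable_scoreAt (σ := σ) hp
  refine memLp_two_of_lintegral_exp hm.aestronglyMeasurable
    (mul_pos hc₀ (pow_pos (noise_pos hσ hτ₀) 2)) ?_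
  rw [lintegral_prod_symm _ (by fun_prop)]
  exact (lintegral_exp_scoreAt_le hK hc₀ hσ hτ₀ hp).trans_lt
      (ENNReal.mul_lt_top (measure_lt_top _ _) ENNReal.ofReal_lt_top)

theorem ae_memLp_scoreAt :
    ∀ᵐ x ∂(law p), MemLp (scoreAt σ p x) 2 (lossMeasure d τ₀ τ₁) := by
  have := isProbabilityMeasure_law hp
  have hm := measurable_scoreAt (σ := σ) hp
  have h1 := integrable_sq_norm_of_memLp
    (memLp_scoreAt_prod (τ₁ := τ₁) hK hc₀ hσ hτ₀ hp)
  filter_upwards [h1.prod_right_ae] with x hx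
  exact (memLp_two_iff_integrable_sq_norm hm.of_uncurry_left.aestronglyMeasurable).mpr hx

variable {s : ℝ → Vec d → Vec d} {V : ℝ} (hs : Measurable (Function.uncurry s))
  (hV : ∀ t ∈ Icc τ₀ τ₁, ∀ x, ‖s t x‖ ≤ V)

include hs hV

/-- The cross term of the excess loss has mean zero at each time, by Tweedie's formula. -/
theorem integral_inner_slice_eq_zero {t : ℝ} (ht : t ∈ Icc τ₀ τ₁) :
    ∫ z, ∫ x, inner ℝ (s t (noised σ x (t, z)) - scoreAt σ p x (t, z))
      (scoreAt σ p x (t, z) + scaledNoise σ (t, z)) ∂(law p) ∂(stdGaussian (Vec d)) = 0 := by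
  have := isProbabilityMeasure_law hp
  have ht0 : 0 < t := hτ₀.trans_le ht.1
  have hk := mul_pos hc₀ (pow_pos (noise_pos hσ hτ₀) 2)
  have hst : Measurable (s t) := hs.of_uncurry_left
  have htw : Measurable (tweedie (noise σ t) (Real.exp (-t)) (law p)) :=
    measurable_tweedie measurable_const measurable_const measurable_id
  have hn : Measurable fun q : Vec d × Vec d => Real.exp (-t) • q.1 + noise σ t • q.2 := by
    fun_prop
  have hb : MemLp (fun q : Vec d × Vec d => tweedie (noise σ t) (Real.exp (-t)) (law p)
      (Real.exp (-t) • q.1 + noise σ t • q.2)) 2 ((law p).prod (stdGaussian (Vec d))) := by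
    refine memLp_two_of_lintegral_exp (htw.comp hn).aestronglyMeasurable hk ?_
    rw [lintegral_prod _ (by fun_prop)]
    exact (lintegral_exp_scoreAt_slice_le hK hc₀ hσ hτ₀ hp ht.1).trans_lt ENNReal.ofReal_lt_top
  have ha : MemLp (fun q : Vec d × Vec d => s t (Real.exp (-t) • q.1 + noise σ t • q.2)) 2
      ((law p).prod (stdGaussian (Vec d))) :=
    MemLp.of_bound (hst.comp hn).aestronglyMeasurable V
      (Filter.Eventually.of_forall fun q => hV t ht _)
  have hζ : MemLp (fun q : Vec d × Vec d => (noise σ t)⁻¹ • q.2) 2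
      ((law p).prod (stdGaussian (Vec d))) := by
    refine memLp_two_of_lintegral_exp (by fun_prop) hk ?_
    rw [lintegral_prod _ (by fun_prop)]
    simp only [lintegral_const, measure_univ, mul_one]
    exact (lintegral_exp_inv_noise_le hK hc₀ hσ hτ₀ ht.1).trans_lt ENNReal.ofReal_lt_top
  have hI := integrable_inner_of_memLp (ha.sub hb) (hb.add hζ)
  simp only [Pi.sub_apply, Pi.add_apply] at hI
  have h0 := integral_inner_tweedie_add_eq_zero (μ := law p) (noise_pos hσ ht0) (Real.exp (-t))
    (F := fun y => s t y - tweedie (noise σ t) (Real.exp (-t)) (law p) y) (hst.sub htw) hI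
  rw [← h0, integral_prod_symm _ hI]
  rfl

theorem memLp_sub_prod : MemLp (fun q : Vec d × (ℝ × Vec d) =>
    s q.2.1 (noised σ q.1 q.2) - scoreAt σ p q.1 q.2) 2
      ((law p).prod (lossMeasure d τ₀ τ₁)) := by
  have := isProbabilityMeasure_law hp
  have ha : MemLp (fun q : Vec d × (ℝ × Vec d) => s q.2.1 (noised σ q.1 q.2)) 2
      ((law p).prod (lossMeasure d τ₀ τ₁)) := by
    refine MemLp.of_bound (measurable_comp_noised hs).aestronglyMeasurable V ?_
    filter_upwards [Measure.quasiMeasurePreserving_snd.ae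
      (ae_lossMeasure_fst_mem (d := d) (τ₀ := τ₀) (τ₁ := τ₁))] with q hq using hV _ hq _
  exact ha.sub (memLp_scoreAt_prod hK hc₀ hσ hτ₀ hp)

/-- The excess risk is the squared distance to the true score. -/
theorem integral_excessLoss_eq :
    ∫ x, excessLoss σ τ₀ τ₁ p s x ∂(law p) = ∫ x, scoreDist σ τ₀ τ₁ p s x ∂(law p) := by
  have := isProbabilityMeasure_law hp
  set ρ := lossMeasure d τ₀ τ₁ with hρ
  have hsub := memLp_sub_prod hK hc₀ hσ hτ₀ hp hs hV
  have hb := memLp_scoreAt_prod (τ₁ := τ₁) hK hc₀ hσ hτ₀ hp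
  have hζ : MemLp (fun q : Vec d × (ℝ × Vec d) => scaledNoise σ q.2) 2 ((law p).prod ρ) :=
    (memLp_scaledNoise hK hc₀ hσ hτ₀).comp_snd (law p)
  have hI : Integrable (Function.uncurry fun (x : Vec d) (w : ℝ × Vec d) =>
      inner ℝ (s w.1 (noised σ x w) - scoreAt σ p x w) (scoreAt σ p x w + scaledNoise σ w))
      ((law p).prod ρ) := integrable_inner_of_memLp hsub (hb.add hζ)
  have h0 : ∫ x, ∫ w, inner ℝ (s w.1 (noised σ x w) - scoreAt σ p x w)
      (scoreAt σ p x w + scaledNoise σ w) ∂ρ ∂(law p) = 0 := by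
    rw [integral_integral_swap hI, hρ, lossMeasure]
    rw [hρ, lossMeasure] at hI
    have hJ : Integrable (fun w => ∫ x, inner ℝ (s w.1 (noised σ x w) - scoreAt σ p x w)
        (scoreAt σ p x w + scaledNoise σ w) ∂(law p))
        ((volume.restrict (Icc τ₀ τ₁)).prod (stdGaussian (Vec d))) := hI.integral_prod_right
    rw [integral_prod _ hJ]
    refine setIntegral_eq_zero_of_forall_eq_zero fun t ht => ?_
    exact integral_inner_slice_eq_zero hK hc₀ hσ hτ₀ hp hs hV ht
  have h1 : excessLoss σ τ₀ τ₁ p s =ᵐ[law p] fun x => scoreDist σ τ₀ τ₁ p s x +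
      2 * ∫ w, inner ℝ (s w.1 (noised σ x w) - scoreAt σ p x w)
        (scoreAt σ p x w + scaledNoise σ w) ∂ρ := by
    filter_upwards [ae_memLp_scoreAt (τ₁ := τ₁) hK hc₀ hσ hτ₀ hp] with x hx
    exact integral_norm_add_sq_sub_eq (memLp_comp_noised hs hV x) hx
      (memLp_scaledNoise hK hc₀ hσ hτ₀)
  have h2 : Integrable (scoreDist σ τ₀ τ₁ p s) (law p) :=
    (integrable_sq_norm_of_memLp hsub).integral_prod_left
  have h3 : Integrable (fun x => ∫ w, inner ℝ (s w.1 (noised σ x w) - scoreAt σ p x w)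
      (scoreAt σ p x w + scaledNoise σ w) ∂ρ) (law p) := hI.integral_prod_left
  rw [integral_congr_ae h1, integral_add h2 (h3.const_mul 2),
    integral_const_mul, h0, mul_zero, add_zero]

theorem scoreError_eq :
    scoreError σ p τ₀ τ₁ s = ENNReal.ofReal (∫ x, scoreDist σ τ₀ τ₁ p s x ∂(law p)) := by
  have := isProbabilityMeasure_law hp
  have hI := integrable_sq_norm_of_memLp
    (memLp_sub_prod (τ₁ := τ₁) hK hc₀ hσ hτ₀ hp hs hV)
  have h1 := ofReal_integral_integral_eq hI fun _ => sq_nonneg _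
  refine Eq.trans ?_ h1.symm
  rw [lossMeasure, lintegral_prod _
    (measurable_ofReal_sq_dist hp hs).lintegral_prod_left'.aemeasurable, scoreError]
  refine setLIntegral_congr_fun measurableSet_Icc fun t ht => ?_
  refine (lintegral_score_slice hσ hp (hτ₀.trans_le ht.1) hs.of_uncurry_left).trans ?_
  exact lintegral_lintegral_swap ((measurable_ofReal_sq_dist hp hs).comp
    (f := fun q : Vec d × Vec d => (q.1, (t, q.2))) (by fun_prop)).aemeasurable

end Moments

end Excess

/-! ### Covering numbers and the oracle inequality -/

section Cover

variable {d : ℕ} {τ₀ τ₁ : ℝ}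

theorem norm_sub_le_of_edist_restrict_le {s s' : ℝ → Vec d → Vec d} {δ : ℝ≥0}
    (h : edist (restrict τ₀ τ₁ s) (restrict τ₀ τ₁ s') ≤ δ) {t : ℝ} (ht : t ∈ Icc τ₀ τ₁)
    (x : Vec d) : ‖s t x - s' t x‖ ≤ δ := by
  have h1 := UniformFun.edist_le.mp h (⟨t, ht⟩, x)
  rw [edist_nndist, ENNReal.coe_le_coe] at h1
  rw [← dist_eq_norm, ← coe_nndist]
  exact_mod_cast h1

/-- A finite covering number yields a finite subset of the class and a map `r` onto it that moves
no function by more than `1 / n` in sup-norm. -/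
theorem exists_finset_cover {n : ℕ} {S : Set (ℝ → Vec d → Vec d)}
    (h : coverNum τ₀ τ₁ n S ≠ ⊤) :
    ∃ (T : Finset (ℝ → Vec d → Vec d)) (r : (ℝ → Vec d → Vec d) → (ℝ → Vec d → Vec d)),
      (∀ s ∈ T, s ∈ S) ∧ (T.card : ℕ∞) ≤ coverNum τ₀ τ₁ n S ∧ (∀ s ∈ S, r s ∈ T) ∧
      ∀ s ∈ S, ∀ t ∈ Icc τ₀ τ₁, ∀ x, ‖s t x - r s t x‖ ≤ (n : ℝ)⁻¹ := by
  classical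
  obtain ⟨C, hCS, hfin, hcov, hcard⟩ := Metric.exists_set_encard_eq_coveringNumber h
  have hCS' : ∀ f ∈ C, ∃ s ∈ S, restrict τ₀ τ₁ s = f := fun f hf => hCS hf
  choose! g hg using hCS'
  have hcov' : ∀ f ∈ restrict τ₀ τ₁ '' S, ∃ c ∈ C, edist f c ≤ ((n : ℝ≥0)⁻¹ : ℝ≥0) :=
    fun f hf => hcov hf
  choose! q hq using hcov'
  refine ⟨hfin.toFinset.image g, fun s => g (q (restrict τ₀ τ₁ s)), ?_, ?_, ?_, ?_⟩
  · intro s hs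
    obtain ⟨c, hc, rfl⟩ := Finset.mem_image.mp hs
    exact (hg c (hfin.mem_toFinset.mp hc)).1
  · have h1 : ((hfin.toFinset.image g).card : ℕ∞) ≤ hfin.toFinset.card := by
      exact_mod_cast Finset.card_image_le
    rwa [← hfin.encard_eq_coe_toFinset_card, hcard] at h1
  · intro s hs
    exact Finset.mem_image_of_mem g (hfin.mem_toFinset.mpr (hq _ (mem_image_of_mem _ hs)).1)
  · intro s hs t ht x
    obtain ⟨h1, h2⟩ := hq _ (mem_image_of_mem (restrict τ₀ τ₁) hs)
    rw [← (hg _ h1).2] at h2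
    have := norm_sub_le_of_edist_restrict_le h2 ht x
    simpa using this

theorem logCover_top (n : ℕ) : logCover ⊤ n = ⊤ := by
  simp [logCover]

theorem ofReal_log_le_logCover {m n : ℕ} {N : ℕ∞} (hn : 1 ≤ n) (h : (m : ℕ∞) ≤ N) :
    ENNReal.ofReal (Real.log (max m n : ℕ)) ≤ logCover N n := by
  have hmax : (1 : ℕ) ≤ max m n := hn.trans (le_max_right _ _)
  have h1 : ((max m n : ℕ) : ℝ≥0∞) ≤ max (N : ℝ≥0∞) (n : ℝ≥0∞) := by
    rcases max_choice m n with h' | h' <;> rw [h']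
    · exact le_max_of_le_left (by exact_mod_cast ENat.toENNReal_le.mpr h)
    · exact le_max_right _ _
  have h2 : ENNReal.log ((max m n : ℕ) : ℝ≥0∞) = ((Real.log (max m n : ℕ) : ℝ) : EReal) := by
    rw [ENNReal.log_pos_real' (by simp; omega)]
    simp
  have h3 := EReal.toENNReal_le_toENNReal (ENNReal.log_monotone h1)
  rw [h2] at h3
  exact h3

end Cover

/-- The exponential scale of the envelope is at most a multiple of `(τ₁ - τ₀) g(τ₀, σ, V)`. -/
theorem envelope_scale_le {σ τ₀ τ₁ V c₀ : ℝ} (hσ : 0 < σ) (hτ₀ : 0 < τ₀) (hτ : τ₀ ≤ τ₁)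
    (hc₀ : 0 < c₀) :
    (τ₁ - τ₀) * (2 + V ^ 2 + 2 / (c₀ * noise σ τ₀ ^ 2)) ≤
      (2 + 2 / c₀) * (τ₁ - τ₀) * gFactor τ₀ σ V := by
  have h1 : 0 ≤ (1 + σ + σ⁻¹) ^ 4 * (1 + τ₀⁻¹) := by positivity
  have h2 : 2 / (c₀ * noise σ τ₀ ^ 2) =
      2 / c₀ * (1 / (σ ^ 2 * (1 - Real.exp (-2 * τ₀)))) := by
    rw [← noise_sq hτ₀.le]; field_simp
  have h3 : 0 ≤ 1 / (σ ^ 2 * (1 - Real.exp (-2 * τ₀))) := by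
    rw [← noise_sq hτ₀.le]; positivity
  have h4 : 0 ≤ 2 / c₀ := by positivity
  have h5 : 2 + V ^ 2 + 2 / (c₀ * noise σ τ₀ ^ 2) ≤ (2 + 2 / c₀) * gFactor τ₀ σ V := by
    rw [h2, gFactor]
    nlinarith [sq_nonneg V, mul_nonneg h4 (sq_nonneg V), mul_nonneg h4 h1]
  have h6 : 0 ≤ τ₁ - τ₀ := by linarith
  calc _ ≤ (τ₁ - τ₀) * ((2 + 2 / c₀) * gFactor τ₀ σ V) := by gcongr
    _ = _ := by ring

theorem gFactor_pos {σ τ₀ V : ℝ} (hσ : 0 < σ) (hτ₀ : 0 < τ₀) : 0 < gFactor τ₀ σ V := by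
  have h1 : 0 ≤ 1 / (σ ^ 2 * (1 - Real.exp (-2 * τ₀))) := by
    rw [← noise_sq hτ₀.le]; positivity
  unfold gFactor
  positivity

/-- The oracle inequality for a class with finite covering number, with explicit constants: the
standard Gaussian has exponential square moment `K` for the constant `c₀`. -/
theorem lintegral_scoreError_le {d : ℕ} {c₀ K : ℝ}
    (hK : ∫⁻ z, ENNReal.ofReal (Real.exp (c₀ * ‖z‖ ^ 2)) ∂(stdGaussian (Vec d)) ≤
      ENNReal.ofReal K) (hc₀ : 0 < c₀) (hK1 : 1 ≤ K) {σ : ℝ} (hσ : 0 < σ) {p : Vec d → ℝ}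
    (hp : IsProbDensity p) {n : ℕ} (hn : 2 ≤ n) {τ₀ τ₁ : ℝ} (hτ₀ : 0 < τ₀) (hτ : τ₀ < τ₁) {V : ℝ}
    {S : Set (ℝ → Vec d → Vec d)} (hSmeas : ∀ s ∈ S, Measurable (Function.uncurry s))
    (hSbdd : ∀ s ∈ S, ∀ t ∈ Icc τ₀ τ₁, ∀ x, ‖s t x‖ ≤ V)
    {Ω : Type*} [MeasurableSpace Ω] {P : Measure Ω} [IsProbabilityMeasure P]
    {X : Fin n → Ω → Vec d} (hX : ∀ i, Measurable (X i)) (hind : iIndepFun X P)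
    (hlaw : ∀ i, P.map (X i) = law p) {shat : Ω → ℝ → Vec d → Vec d}
    (herm : ∀ᵐ ω ∂P, shat ω ∈ S ∧
      IsMinOn (empiricalRisk σ τ₀ τ₁ (fun i => X i ω)) S (shat ω))
    {T : Finset (ℝ → Vec d → Vec d)} {r : (ℝ → Vec d → Vec d) → (ℝ → Vec d → Vec d)}
    (hTS : ∀ s ∈ T, s ∈ S) (hr : ∀ s ∈ S, r s ∈ T)
    (hcover : ∀ s ∈ S, ∀ t ∈ Icc τ₀ τ₁, ∀ x, ‖s t x - r s t x‖ ≤ (n : ℝ)⁻¹)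
    {s : ℝ → Vec d → Vec d} (hs : s ∈ S) :
    ∫⁻ ω, scoreError σ p τ₀ τ₁ (shat ω) ∂P ≤ 2 * scoreError σ p τ₀ τ₁ s +
      ENNReal.ofReal (120 * 12 * (Real.exp 1 * K) ^ 2 * ((2 + 2 / c₀) * (τ₁ - τ₀) *
        gFactor τ₀ σ V) * Real.log n * Real.log (max T.card n : ℕ) / n) := by
  have := isProbabilityMeasure_law hp
  set k := c₀ * noise σ τ₀ ^ 2 with hk
  have hk0 : 0 < k := mul_pos hc₀ (pow_pos (noise_pos hσ hτ₀) 2)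
  have hD : (lossMeasure d τ₀ τ₁).real univ = τ₁ - τ₀ := lossMeasure_real_univ hτ.le
  have hD0 : 0 < τ₁ - τ₀ := by linarith
  set κ := (τ₁ - τ₀) * (2 + V ^ 2 + 2 / k) with hκ
  have hκ0 : 0 < κ := by positivity
  have hζ : MemLp (scaledNoise σ) 2 (lossMeasure d τ₀ τ₁) := memLp_scaledNoise hK hc₀ hσ hτ₀
  set U : Vec d → ℝ := fun x =>
    envelope (lossMeasure d τ₀ τ₁) V (scoreAt σ p x) (scaledNoise σ) with hU
  have hscore := ae_memLp_scoreAt (τ₁ := τ₁) hK hc₀ hσ hτ₀ hp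
  have hexp : ∫⁻ x, ENNReal.ofReal (Real.exp (U x / κ)) ∂(law p) ≤
      ENNReal.ofReal (Real.exp 1 * K) := by
    rw [hκ, ← hD]
    refine lintegral_exp_envelope_le (ζ := fun _ => scaledNoise σ) (by rw [hD]; exact hD0)
      (measurable_scoreAt hp) (measurable_scaledNoise.comp measurable_snd) hk0
      (lintegral_exp_scoreAt_le hK hc₀ hσ hτ₀ hp) ?_
    simp only [lintegral_const, measure_univ, mul_one]
    exact lintegral_exp_scaledNoise_le hK hc₀ hσ hτ₀
  have hbound : ∀ᵐ x ∂(law p), 0 ≤ U x ∧ ∀ s ∈ S, 0 ≤ scoreDist σ τ₀ τ₁ p s x ∧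
      scoreDist σ τ₀ τ₁ p s x ≤ 12 * U x ∧ |excessLoss σ τ₀ τ₁ p s x| ≤ 12 * U x ∧
      excessLoss σ τ₀ τ₁ p s x ^ 2 ≤ 12 * U x * scoreDist σ τ₀ τ₁ p s x := by
    filter_upwards [hscore] with x hx
    have hU0 : 0 ≤ U x := envelope_nonneg _ _ _
    refine ⟨hU0, fun s hs => ?_⟩
    have ha := memLp_comp_noised (σ := σ) (hSmeas s hs) (hSbdd s hs) x
    have haV := ae_norm_comp_noised_le (σ := σ) (hSbdd s hs) x
    refine ⟨integral_nonneg fun _ => sq_nonneg _, ?_, abs_excess_loss_le ha hx hζ haV,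
      sq_excess_loss_le ha hx hζ haV⟩
    exact (integral_norm_sub_sq_le ha hx hζ haV).trans (by linarith)
  have hcov : ∀ᵐ x ∂(law p), ∀ s ∈ S,
      |excessLoss σ τ₀ τ₁ p s x - excessLoss σ τ₀ τ₁ p (r s) x| ≤ U x / n := by
    filter_upwards [hscore] with x hx s hs
    have hrS := hTS _ (hr s hs)
    rw [excessLoss, excessLoss, sub_sub_sub_cancel_right, div_eq_inv_mul]
    refine abs_loss_sub_le (memLp_comp_noised (hSmeas s hs) (hSbdd s hs) x)
      (memLp_comp_noised (hSmeas _ hrS) (hSbdd _ hrS) x) hx hζ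
      (ae_norm_comp_noised_le (hSbdd s hs) x) (ae_norm_comp_noised_le (hSbdd _ hrS) x)
      (by positivity) ?_
    filter_upwards [ae_lossMeasure_fst_mem] with w hw using hcover s hs _ hw _
  have herm' : ∀ᵐ ω ∂P, shat ω ∈ S ∧ ∀ s ∈ S, ∑ i, excessLoss σ τ₀ τ₁ p (shat ω) (X i ω) ≤
      ∑ i, excessLoss σ τ₀ τ₁ p s (X i ω) := by
    filter_upwards [herm] with ω hω
    refine ⟨hω.1, fun s hs => ?_⟩
    have h1 := isMinOn_iff.mp hω.2 s hs
    have hn0 : (0 : ℝ) < (n : ℝ)⁻¹ := by positivity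
    have h2 := le_of_mul_le_mul_left h1 hn0
    have h3 : ∀ s' ∈ S, ∀ i, excessLoss σ τ₀ τ₁ p s' (X i ω) = loss σ τ₀ τ₁ s' (X i ω) -
        ∫ w, ‖scoreAt σ p (X i ω) w + scaledNoise σ w‖ ^ 2 ∂(lossMeasure d τ₀ τ₁) :=
      fun s' hs' i => by
        rw [loss_eq hK hc₀ hσ hτ₀ (hSmeas s' hs') (hSbdd s' hs') hτ.le, excessLoss]
    simp only [h3 _ hω.1, h3 _ hs, Finset.sum_sub_distrib]
    linarith
  have hmain := lintegral_excess_risk_le (c := 12) (K₀ := Real.exp 1 * K) (by norm_num) hκ0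
    (one_le_mul_of_one_le_of_one_le (Real.one_le_exp zero_le_one) hK1)
    (fun s hs => measurable_excessLoss hp (hSmeas s hs))
    (fun s hs => measurable_scoreDist hp (hSmeas s hs)) (measurable_envelope hp V) hexp hbound
    (fun s hs => integral_excessLoss_eq hK hc₀ hσ hτ₀ hp (hSmeas s hs) (hSbdd s hs))
    hTS hn hr hcov hX hind hlaw herm' hs
  have hR0 : 0 ≤ ∫ x, scoreDist σ τ₀ τ₁ p s x ∂(law p) :=
    integral_nonneg fun x => integral_nonneg fun _ => sq_nonneg _
  have hlogn : 0 ≤ Real.log n := Real.log_natCast_nonneg n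
  have hlogN : 0 ≤ Real.log (max T.card n : ℕ) := Real.log_natCast_nonneg _
  calc ∫⁻ ω, scoreError σ p τ₀ τ₁ (shat ω) ∂P
      = ∫⁻ ω, ENNReal.ofReal (∫ x, scoreDist σ τ₀ τ₁ p (shat ω) x ∂(law p)) ∂P := by
        refine lintegral_congr_ae ?_
        filter_upwards [herm] with ω hω using
          scoreError_eq hK hc₀ hσ hτ₀ hp (hSmeas _ hω.1) (hSbdd _ hω.1)
    _ ≤ _ := hmain
    _ ≤ _ := by
        rw [ENNReal.ofReal_add (by positivity) (by positivity),
          ENNReal.ofReal_mul zero_le_two, ENNReal.ofReal_ofNat,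
          scoreError_eq hK hc₀ hσ hτ₀ hp (hSmeas _ hs) (hSbdd _ hs)]
        gcongr
        exact envelope_scale_le hσ hτ₀ hτ.le hc₀

end DSM

theorem mainTheorem5 (d : ℕ) (_hd : 3 ≤ d) (β : ℝ) (_hβ : 0 < β) (K : ℝ) (_hK : 0 ≤ K)
    (c : DSM.ScoreConstants) :
    ∃ C C' : ℝ, 0 < C ∧ 0 < C' ∧
      ∀ (σ : ℝ) (_hσ : 0 < σ) (p : DSM.Vec d → ℝ) (_hp : DSM.IsProbDensity p)
        (_hsub : DSM.IsSubGaussian K (DSM.law p)) (_hscore : DSM.ScoreProperties c β σ p)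
        (n : ℕ) (_hn : 2 ≤ n) (τ₀ τ₁ : ℝ) (_hτ₀ : (n : ℝ)⁻¹ ≤ τ₀) (_hτ : τ₀ < τ₁) (V : ℝ)
        (S : Set (ℝ → DSM.Vec d → DSM.Vec d))
        (_hSmeas : ∀ s ∈ S, Measurable (Function.uncurry s))
        (_hSbdd : ∀ s ∈ S, ∀ t ∈ Set.Icc τ₀ τ₁, ∀ x, ‖s t x‖ ≤ V)
        (Ω : Type*) [MeasurableSpace Ω] (P : Measure Ω) [IsProbabilityMeasure P]
        (X : Fin n → Ω → DSM.Vec d) (_hXmeas : ∀ i, Measurable (X i))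
        (_hXindep : iIndepFun X P) (_hXlaw : ∀ i, P.map (X i) = DSM.law p)
        (shat : Ω → ℝ → DSM.Vec d → DSM.Vec d)
        (_hERM : ∀ᵐ ω ∂P, shat ω ∈ S ∧
          IsMinOn (DSM.empiricalRisk σ τ₀ τ₁ (fun i => X i ω)) S (shat ω)),
        ∫⁻ ω, DSM.scoreError σ p τ₀ τ₁ (shat ω) ∂P ≤
          3 * (⨅ s ∈ S, DSM.scoreError σ p τ₀ τ₁ s) +
            ENNReal.ofReal (DSM.cFactor C C' n τ₀ τ₁ σ V / n) *
              DSM.logCover (DSM.coverNum τ₀ τ₁ n S) n := by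
  -- Fernique's theorem provides the exponential square moment of the Gaussian noise.
  obtain ⟨c₀, hc₀, hint⟩ := IsGaussian.exists_integrable_exp_sq (stdGaussian (DSM.Vec d))
  set M := ∫ z, Real.exp (c₀ * ‖z‖ ^ 2) ∂(stdGaussian (DSM.Vec d)) with hM
  have hMle : ∫⁻ z, ENNReal.ofReal (Real.exp (c₀ * ‖z‖ ^ 2)) ∂(stdGaussian (DSM.Vec d)) ≤
      ENNReal.ofReal M :=
    (ofReal_integral_eq_lintegral_ofReal hint
      (Filter.Eventually.of_forall fun _ => (Real.exp_pos _).le)).ge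
  have hM1 : 1 ≤ M := by
    have h1 : ∫ _, (1 : ℝ) ∂(stdGaussian (DSM.Vec d)) ≤ M :=
      integral_mono (integrable_const _) hint fun z => Real.one_le_exp (by positivity)
    simpa using h1
  set C := 120 * 12 * (Real.exp 1 * M) ^ 2 * (2 + 2 / c₀) with hC
  have hC0 : 0 < C := by positivity
  -- One power of `log n` comes from the truncation level.
  refine ⟨C, 1, hC0, one_pos, ?_⟩
  intro σ hσ p hp _ _ n hn τ₀ τ₁ hτ₀n hτ V S hSmeas hSbdd Ω _ P _ X hX hind hlaw shat herm
  have hn0 : (0 : ℝ) < n := by positivity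
  have hτ₀ : 0 < τ₀ := lt_of_lt_of_le (by positivity) hτ₀n
  have hg := DSM.gFactor_pos (V := V) hσ hτ₀
  have hD : 0 < τ₁ - τ₀ := by linarith
  have hlog : 0 < Real.log n := Real.log_pos (by exact_mod_cast hn)
  have hcF : DSM.cFactor C 1 n τ₀ τ₁ σ V = C * (τ₁ - τ₀) * Real.log n * DSM.gFactor τ₀ σ V := by
    rw [DSM.cFactor, Real.rpow_one]
  have hcF0 : 0 < DSM.cFactor C 1 n τ₀ τ₁ σ V / n := by rw [hcF]; positivity
  by_cases hN : DSM.coverNum τ₀ τ₁ n S = ⊤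
  · rw [hN, DSM.logCover_top, ENNReal.mul_top (by simpa using hcF0), add_top]
    exact le_top
  obtain ⟨T, r, hTS, hTcard, hr, hcover⟩ := DSM.exists_finset_cover hN
  rw [ENNReal.mul_iInf_of_ne (by norm_num) (by norm_num), ENNReal.iInf_add]
  refine le_iInf fun s => ?_
  by_cases hs : s ∈ S
  · simp only [hs, iInf_pos]
    refine (DSM.lintegral_scoreError_le hMle hc₀ hM1 hσ hp hn hτ₀ hτ hSmeas hSbdd hX hind hlaw herm
      hTS hr hcover hs).trans ?_
    gcongr ?_ * _ + ?_
    · norm_num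
    · have h1 : 120 * 12 * (Real.exp 1 * M) ^ 2 * ((2 + 2 / c₀) * (τ₁ - τ₀) *
          DSM.gFactor τ₀ σ V) * Real.log n * Real.log (max T.card n : ℕ) / n =
          DSM.cFactor C 1 n τ₀ τ₁ σ V / n * Real.log (max T.card n : ℕ) := by
        rw [hcF, hC]; ring
      rw [h1, ENNReal.ofReal_mul hcF0.le]
      gcongr
      exact DSM.ofReal_log_le_logCover (by omega) hTcard
  · simp [hs]
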